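/- Consider the M/M/$N$ queue ($N\ge 1$) with two priority classes, non-preemptive (head-of-the-line) discipline, Poisson arrival rates $\lambda_{\rm hi}>0$ and $\lambda_{\rm lo}\ge 0$, and a common exponential service rate $\mu>0$. Put $$r_1=\frac{\lambda_{\rm hi}}{N\mu},\quad r_2=\frac{\lambda_{\rm lo}}{N\mu},\quad r=r_1+r_2,\quad \nu=\frac{r_1}{r},$$ and assume $r<1$. Consider the steady state of the continuous-time Markov chain whose state records the number of busy servers when fewer than $N$ are busy (nobody then waits), and the numbers of waiting low- and high-priority clients when all $N$ servers are busy. Let $f(n,m)$ be the conditional probability that $n$ low-priority and $m$ high-priority clients are waiting, given that all servers are busy, and let $f_{\rm lo}(n)=\sum_{m\ge 0}f(n,m)$. (a) For every $m\ge 0$ and $0\le p<1$, $$\sum_{n\ge 0}p^n f(n,m)=\frac{(1-r)(1-p)}{1-p\,\lambda_2(p)}\,\lambda_1(p)^m ,$$ where $\lambda_1(p)\le\lambda_2(p)$ are the roots of $\lambda^2-(1+r-r_2p)\lambda+r_1=0$. (b) Let $$z_0=\nu,\qquad z_1=\tfrac12\Bigl[1+r-\sqrt{(1+r)^2-4\nu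 r}\Bigr],\qquad z_2=\tfrac12\Bigl[1+r+\sqrt{(1+r)^2-4\nu r}\Bigr].$$ There are closed (piecewise $C^1$) contours $\mathcal C'$ in $\mathbb C$ avoiding $z_0,z_1,z_2$, with winding number $1$ around $z_1$ and winding number $0$ around $z_0$ and $z_2$. For any such contour define $$R^m_n=\frac1{2\pi i}\oint_{\mathcal C'}\frac{1}{z-z_0}\,\frac{z^m}{[(z-z_1)(z-z_2)]^n}\,dz,\qquad \Delta R^m_n=R^{m+1}_n-R^m_n \qquad (m,n\ge 0).$$ Then for all $n,m\ge 0$ $$f(n,m)=\frac{(1-r)(-r_2)^n}{r}\Bigl(\Delta R^{m+n+2}_{n+1}-z_1z_2\,\Delta R^{m+n}_{n+1}\Bigr),$$ $$f_{\rm lo}(n)=-\frac{(1-r)(-r_2)^n}{r}\Bigl(R^{n+2}_{n+1}-z_1z_2\,R^{n}_{n+1}\Bigr),$$ where $(-r_2)^0=1$ also when $r_2=0$. -/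

import Mathlib

/-- States of the two-priority, non-preemptive M/M/`N` queue with a common service rate.
`idle k`: exactly `k < N` servers are busy (and then nobody is waiting);
`busy n m`: all `N` servers are busy, `n` low-priority and `m` high-priority clients are waiting. -/
inductive NPState (N : ℕ) where
  | idle (k : Fin N) : NPState N
  | busy (n m : ℕ) : NPState N
deriving DecidableEq

namespace NPState

variable {N : ℕ}

/-- The state after one more server has been occupied, starting from `k < N` busy servers. -/
def occupy (k : Fin N) : NPState N :=
  if h : k.val + 1 < N then idle ⟨k.val + 1, h⟩ else busy 0 0

/-- The state after the arrival of a high-priority client. -/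
def arriveHi : NPState N → NPState N
  | idle k => occupy k
  | busy n m => busy n (m + 1)

/-- The state after the arrival of a low-priority client. -/
def arriveLo : NPState N → NPState N
  | idle k => occupy k
  | busy n m => busy (n + 1) m

/-- The state after a service completion: the freed server takes a waiting high-priority client
if there is one, otherwise a waiting low-priority client if there is one, otherwise it falls idle.
(In the state with no busy server nothing happens; its completion rate is zero.) -/
def complete [NeZero N] : NPState N → NPState N
  | idle k => idle ⟨k.val - 1, lt_of_le_of_lt (Nat.sub_le _ _) k.isLt⟩
  | busy n (m + 1) => busy n m
  | busy (n + 1) 0 => busy n 0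
  | busy 0 0 => idle ⟨N - 1, Nat.sub_lt (NeZero.pos N) Nat.one_pos⟩

/-- The number of busy servers. -/
def busyServers : NPState N → ℕ
  | idle k => k.val
  | busy _ _ => N

end NPState

/-- Transition rates of the queue: Poisson arrivals with rates `lamHi`, `lamLo`,
exponential service with rate `mu` at each busy server. -/
def npRate {N : ℕ} [NeZero N] (lamHi lamLo mu : ℝ) (s t : NPState N) : ℝ :=
  (if t = s.arriveHi then lamHi else 0) + (if t = s.arriveLo then lamLo else 0)
    + (if t = s.complete then (s.busyServers : ℝ) * mu else 0)

/-- `P` is a stationary (steady-state) probability distribution of the continuous-time Markov chain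
with transition rates `q s t`: for every state, the probability flux in equals the flux out. -/
structure IsSteadyState {S : Type*} (q : S → S → ℝ) (P : S → ℝ) : Prop where
  nonneg : ∀ s, 0 ≤ P s
  total : HasSum P 1
  balance : ∀ t, HasSum (fun s => P s * q s t) (P t * ∑' u, q t u)

/-- The wait-conditional joint PMF: the probability of `n` waiting low-priority and `m` waiting
high-priority clients, given that all servers are busy. -/
noncomputable def waitJoint {N : ℕ} (P : NPState N → ℝ) (n m : ℕ) : ℝ :=
  P (NPState.busy n m) / ∑' x : ℕ × ℕ, P (NPState.busy x.1 x.2)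

/-- The wait-conditional low-priority marginal PMF. -/
noncomputable def waitLow {N : ℕ} (P : NPState N → ℝ) (n : ℕ) : ℝ :=
  ∑' m : ℕ, waitJoint P n m

/-- `cohenLam1 r r₁ r₂ p` is the smaller root of
`x ^ 2 - (1 + r - r₂ * p) * x + r₁ = 0`. -/
noncomputable def cohenLam1 (r r₁ r₂ p : ℝ) : ℝ :=
  ((1 + r - r₂ * p) - √((1 + r - r₂ * p) ^ 2 - 4 * r₁)) / 2

/-- `cohenLam2 r r₁ r₂ p` is the larger root of
`x ^ 2 - (1 + r - r₂ * p) * x + r₁ = 0`. -/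
noncomputable def cohenLam2 (r r₁ r₂ p : ℝ) : ℝ :=
  ((1 + r - r₂ * p) + √((1 + r - r₂ * p) ^ 2 - 4 * r₁)) / 2

/-- The point `z₁`. -/
noncomputable def poleOne (r ν : ℝ) : ℝ := (1 + r - √((1 + r) ^ 2 - 4 * ν * r)) / 2

/-- The point `z₂`. -/
noncomputable def poleTwo (r ν : ℝ) : ℝ := (1 + r + √((1 + r) ^ 2 - 4 * ν * r)) / 2

/-- The contour integral of `g` along the curve `γ : [0, 1] → ℂ`, divided by `2 π i`. -/
noncomputable def contourInt (γ : ℝ → ℂ) (g : ℂ → ℂ) : ℂ :=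
  (2 * (Real.pi : ℂ) * Complex.I)⁻¹ * ∫ t in (0 : ℝ)..1, g (γ t) * deriv γ t

/-- The winding number of the closed curve `γ` around `a`. -/
noncomputable def windingNo (γ : ℝ → ℂ) (a : ℂ) : ℂ :=
  contourInt γ (fun z => (z - a)⁻¹)

/-- Closed contours parametrized by `[0, 1]`: continuous, continuously differentiable apart from
finitely many parameters, with integrable velocity.  Every closed piecewise `C¹` curve qualifies. -/
structure IsClosedContour (γ : ℝ → ℂ) : Prop where
  continuousOn : ContinuousOn γ (Set.Icc 0 1)
  closed : γ 0 = γ 1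
  smooth : ∃ S : Finset ℝ, ∀ t ∈ Set.Ioo (0 : ℝ) 1, t ∉ S →
    DifferentiableAt ℝ γ t ∧ ContinuousAt (deriv γ) t
  integrable : IntervalIntegrable (deriv γ) MeasureTheory.volume 0 1

/-- `γ` is a closed contour that encloses `z₁` once anti-clockwise and has `z₀`, `z₂` in its
exterior. -/
structure IsRContour (z₀ z₁ z₂ : ℂ) (γ : ℝ → ℂ) : Prop where
  contour : IsClosedContour γ
  avoids : ∀ t ∈ Set.Icc (0 : ℝ) 1, γ t ≠ z₀ ∧ γ t ≠ z₁ ∧ γ t ≠ z₂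
  encloses : windingNo γ z₁ = 1
  exterior₀ : windingNo γ z₀ = 0
  exterior₂ : windingNo γ z₂ = 0

/-- The R-integral `R^m_n` along the contour `γ`. -/
noncomputable def rInt (γ : ℝ → ℂ) (z₀ z₁ z₂ : ℂ) (m n : ℕ) : ℂ :=
  contourInt γ (fun z => 1 / (z - z₀) * (z ^ m / ((z - z₁) * (z - z₂)) ^ n))

/-- The difference `ΔR^m_n = R^(m+1)_n - R^m_n`. -/
noncomputable def deltaRInt (γ : ℝ → ℂ) (z₀ z₁ z₂ : ℂ) (m n : ℕ) : ℂ :=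
  rInt γ z₀ z₁ z₂ (m + 1) n - rInt γ z₀ z₁ z₂ m n

/-! Cuts between numbers of busy servers eliminate the idle states, so `f` satisfies a closed system
of balance equations (`WaitBalance`, obtained in `waitBalance_waitJoint`).

For (a), summing these equations against `p ^ n` gives a linear recurrence in `m` whose
characteristic roots are `λ₁(p)` and `λ₂(p)`. Solutions tend to zero by summability while `λ₂ ≥ 1`,
so only `λ₁ ^ m` survives (`eq_pow_mul_of_recurrence`). The equation at `m = 0` fixes the prefactor
up to `f 0 0`, and letting `p → 1` gives `f 0 0 = 1 - r`.

For (b), no coefficients are extracted from (a). Instead the integral expression is shown to solve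
the same balance equations. With `Q = (z - z₁) * (z - z₂)`, `jointInt` is the integral of `(z - 1) *
(z² - z₁z₂) / (z - z₀) * z ^ m / Q ^ n`. Expanding `Q` gives the interior recurrence. The equation
at `m = 0` holds because the pole at `z₀` cancels and the rest is a combination of derivatives of
powers of `z / Q` (`jointInt_boundary`). Induction on `n` then works row by row: two decaying
solutions of the recurrence agree once they agree at `m = 0`. The marginal follows by telescoping in
`m`.

Contours are arbitrary, so integrals are evaluated only from primitives, partial fractions and the
three winding numbers. -/

open Filter Topology

/-! ### Contour integrals, primitives and circular contours. -/

section Contour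

variable {γ : ℝ → ℂ}

theorem IsClosedContour.intervalIntegrable (hγ : IsClosedContour γ) {g : ℂ → ℂ}
    (hg : ContinuousOn g (γ '' Set.Icc 0 1)) :
    IntervalIntegrable (fun t => g (γ t) * deriv γ t) MeasureTheory.volume 0 1 := by
  refine hγ.integrable.continuousOn_mul ?_
  rw [Set.uIcc_of_le zero_le_one]
  exact hg.comp hγ.continuousOn (Set.mapsTo_image _ _)

theorem contourInt_add (hγ : IsClosedContour γ) {g h : ℂ → ℂ}
    (hg : ContinuousOn g (γ '' Set.Icc 0 1)) (hh : ContinuousOn h (γ '' Set.Icc 0 1)) :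
    contourInt γ (fun z => g z + h z) = contourInt γ g + contourInt γ h := by
  simp only [contourInt, add_mul]
  rw [intervalIntegral.integral_add (hγ.intervalIntegrable hg) (hγ.intervalIntegrable hh)]
  ring

theorem contourInt_const_mul (c : ℂ) (g : ℂ → ℂ) :
    contourInt γ (fun z => c * g z) = c * contourInt γ g := by
  simp only [contourInt, mul_assoc, intervalIntegral.integral_const_mul]
  ring

theorem contourInt_sub (hγ : IsClosedContour γ) {g h : ℂ → ℂ}
    (hg : ContinuousOn g (γ '' Set.Icc 0 1)) (hh : ContinuousOn h (γ '' Set.Icc 0 1)) :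
    contourInt γ (fun z => g z - h z) = contourInt γ g - contourInt γ h := by
  simp only [contourInt, sub_mul]
  rw [intervalIntegral.integral_sub (hγ.intervalIntegrable hg) (hγ.intervalIntegrable hh)]
  ring

theorem contourInt_congr {g h : ℂ → ℂ} (H : Set.EqOn g h (γ '' Set.Icc 0 1)) :
    contourInt γ g = contourInt γ h := by
  unfold contourInt
  congr 1
  refine intervalIntegral.integral_congr fun t ht => ?_
  rw [Set.uIcc_of_le zero_le_one] at ht
  simp only [H (Set.mem_image_of_mem γ ht)]

/-- The integral of a derivative along a closed contour vanishes. -/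
theorem contourInt_eq_zero_of_hasDerivAt (hγ : IsClosedContour γ) {F g : ℂ → ℂ}
    (hF : ∀ z ∈ γ '' Set.Icc 0 1, HasDerivAt F (g z) z)
    (hg : ContinuousOn g (γ '' Set.Icc 0 1)) : contourInt γ g = 0 := by
  obtain ⟨S, hS⟩ := hγ.smooth
  have hc : ContinuousOn (F ∘ γ) (Set.Icc 0 1) :=
    ContinuousOn.comp (fun z hz => (hF z hz).continuousAt.continuousWithinAt) hγ.continuousOn
      (Set.mapsTo_image _ _)
  have key := MeasureTheory.integral_eq_of_hasDerivAt_off_countable_of_le (F ∘ γ)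
    (fun t => g (γ t) * deriv γ t) zero_le_one S.countable_toSet hc
    (fun t ht => (hF _ (Set.mem_image_of_mem γ (Set.Ioo_subset_Icc_self ht.1))).comp t
      (hS t ht.1 ht.2).1.hasDerivAt) (hγ.intervalIntegrable hg)
  simp [contourInt, key, hγ.closed]

theorem contourInt_pow (hγ : IsClosedContour γ) (m : ℕ) : contourInt γ (fun z => z ^ m) = 0 := by
  refine contourInt_eq_zero_of_hasDerivAt hγ (F := fun z => z ^ (m + 1) / ((m + 1 : ℕ) : ℂ))
    (fun z _ => ?_) (by fun_prop)
  have h := (hasDerivAt_pow (m + 1) z).div_const ((m + 1 : ℕ) : ℂ)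
  refine h.congr_deriv ?_
  have : ((m + 1 : ℕ) : ℂ) ≠ 0 := by exact_mod_cast Nat.succ_ne_zero m
  rw [Nat.add_sub_cancel, mul_div_cancel_left₀ _ this]

theorem contourInt_inv_pow (hγ : IsClosedContour γ) {a : ℂ} (ha : a ∉ γ '' Set.Icc 0 1) (b : ℕ) :
    contourInt γ (fun z => ((z - a) ^ (b + 2))⁻¹) = 0 := by
  have hne : ∀ z ∈ γ '' Set.Icc 0 1, z - a ≠ 0 := fun z hz h => ha (sub_eq_zero.1 h ▸ hz)
  refine contourInt_eq_zero_of_hasDerivAt hγ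
    (F := fun z => -((z - a) ^ (b + 1))⁻¹ / ((b + 1 : ℕ) : ℂ)) (fun z hz => ?_)
    (ContinuousOn.inv₀ (by fun_prop) fun z hz => pow_ne_zero _ (hne z hz))
  have h := (((((hasDerivAt_id z).sub_const a).pow (b + 1)).inv
    (pow_ne_zero _ (hne z hz))).neg).div_const ((b + 1 : ℕ) : ℂ)
  refine h.congr_deriv ?_
  have h1 : ((b + 1 : ℕ) : ℂ) ≠ 0 := by exact_mod_cast Nat.succ_ne_zero b
  have h2 := hne z hz
  simp only [id]
  field_simp
  simp only [Nat.add_sub_cancel, Pi.pow_apply]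
  ring

/-- A circle around `c` whose closed disc misses `z₀` and `z₂` is an admissible contour. -/
theorem isRContour_circle {z₀ c z₂ : ℂ} {ρ : ℝ} (hρ : 0 < ρ) (h₀ : ρ < ‖z₀ - c‖)
    (h₂ : ρ < ‖z₂ - c‖) :
    IsRContour z₀ c z₂ (fun t : ℝ => c + ρ * Complex.exp (2 * Real.pi * Complex.I * t)) := by
  set γ : ℝ → ℂ := fun t : ℝ => c + ρ * Complex.exp (2 * Real.pi * Complex.I * t) with hγ
  have hder : ∀ t : ℝ, HasDerivAt γ
      (ρ * (Complex.exp (2 * Real.pi * Complex.I * t) * (2 * Real.pi * Complex.I))) t := by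
    intro t
    have h1 : HasDerivAt (fun t : ℝ => 2 * Real.pi * Complex.I * (t : ℂ))
        (2 * Real.pi * Complex.I) t := by
      simpa using (Complex.ofRealCLM.hasDerivAt (x := t)).const_mul (2 * Real.pi * Complex.I)
    exact ((h1.cexp).const_mul (ρ : ℂ)).const_add c
  have hd : deriv γ = fun t : ℝ =>
      (ρ : ℂ) * (Complex.exp (2 * Real.pi * Complex.I * t) * (2 * Real.pi * Complex.I)) :=
    funext fun t => (hder t).deriv
  have hdc : Continuous (deriv γ) := by rw [hd]; fun_prop
  have hcont : Continuous γ := by fun_prop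
  have hnorm : ∀ t, ‖γ t - c‖ = ρ := by
    intro t
    have : (2 * Real.pi * Complex.I * t : ℂ) = ((2 * Real.pi * t : ℝ) : ℂ) * Complex.I := by
      push_cast; ring
    simp only [hγ, add_sub_cancel_left, norm_mul, this, Complex.norm_exp_ofReal_mul_I]
    simp [abs_of_pos hρ]
  have hcl : IsClosedContour γ := by
    refine ⟨hcont.continuousOn, ?_, ⟨∅, fun t _ _ => ⟨(hder t).differentiableAt,
      hdc.continuousAt⟩⟩, hdc.intervalIntegrable _ _⟩
    simp [hγ, Complex.exp_two_pi_mul_I]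
  have hpi : (2 * (Real.pi : ℂ) * Complex.I) ≠ 0 := Complex.two_pi_I_ne_zero
  have hout : ∀ a : ℂ, ρ < ‖a - c‖ → windingNo γ a = 0 := by
    intro a ha
    have hac : c - a ≠ 0 := by
      intro h
      rw [← norm_neg, neg_sub, h, norm_zero] at ha
      exact absurd ha (not_lt.2 hρ.le)
    have hne : ∀ z ∈ γ '' Set.Icc 0 1, z - a ≠ 0 := by
      rintro _ ⟨t, -, rfl⟩ h
      rw [← sub_eq_zero.1 h, hnorm] at ha
      exact lt_irrefl _ ha
    -- Normalising by `c - a` places the circle inside the unit disc about `1`, where the principal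
    -- logarithm is a primitive.
    refine contourInt_eq_zero_of_hasDerivAt hcl (F := fun z => Complex.log ((z - a) / (c - a)))
      (fun z hz => ?_) (ContinuousOn.inv₀ (by fun_prop) hne)
    have hs : (z - a) / (c - a) ∈ Complex.slitPlane := by
      obtain ⟨t, -, rfl⟩ := hz
      have : (γ t - a) / (c - a) = 1 + (γ t - c) / (c - a) := by field_simp; ring
      rw [this]
      apply Complex.mem_slitPlane_of_norm_lt_one
      rw [norm_div, hnorm, div_lt_one (norm_pos_iff.2 hac), norm_sub_rev]
      exact ha
    refine ((((hasDerivAt_id z).sub_const a).div_const (c - a)).clog hs).congr_deriv ?_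
    have := hne z hz
    simp only [id]
    field_simp
  refine ⟨hcl, fun t _ => ⟨?_, ?_, ?_⟩, ?_, hout _ h₀, hout _ h₂⟩
  · intro h; rw [← h, hnorm] at h₀; exact lt_irrefl _ h₀
  · intro h; have := hnorm t; rw [h, sub_self, norm_zero] at this; exact hρ.ne this
  · intro h; rw [← h, hnorm] at h₂; exact lt_irrefl _ h₂
  · have hρ' : (ρ : ℂ) ≠ 0 := by exact_mod_cast hρ.ne'
    have : ∀ t : ℝ, (γ t - c)⁻¹ * deriv γ t = 2 * Real.pi * Complex.I := by
      intro t
      rw [hd]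
      simp only [hγ, add_sub_cancel_left]
      have := Complex.exp_ne_zero (2 * Real.pi * Complex.I * t)
      field_simp
    simp only [windingNo, contourInt, this, intervalIntegral.integral_const]
    rw [sub_zero, one_smul, inv_mul_cancel₀ hpi]

end Contour

/-! ### Balance equations of the Markov chain. -/

namespace NPState

variable {N : ℕ}

/-- The state with `k` busy servers and nobody waiting, for `k ≤ N`. -/
def noWait (N k : ℕ) : NPState N := if h : k < N then idle ⟨k, h⟩ else busy 0 0

theorem noWait_of_lt {k : ℕ} (h : k < N) : noWait N k = idle ⟨k, h⟩ := by simp [noWait, h]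

theorem noWait_self : noWait N N = busy 0 0 := by simp [noWait]

theorem busy_eq_occupy {k : Fin N} {n m : ℕ} :
    busy n m = occupy k ↔ n = 0 ∧ m = 0 ∧ k.val + 1 = N := by
  have := k.isLt
  unfold occupy
  split_ifs with h
  · simp; omega
  · simp; omega

theorem idle_eq_occupy {k j : Fin N} : idle j = occupy k ↔ j.val = k.val + 1 := by
  have := j.isLt
  unfold occupy
  split_ifs with h
  · simp [Fin.ext_iff]
  · simp; omega

end NPState

section Balance

open NPState

variable {N : ℕ} [NeZero N] {lamHi lamLo mu : ℝ} {P : NPState N → ℝ}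

theorem tsum_npRate (s : NPState N) :
    ∑' u, npRate lamHi lamLo mu s u = lamHi + lamLo + s.busyServers * mu :=
  (((hasSum_ite_eq s.arriveHi lamHi).add (hasSum_ite_eq s.arriveLo lamLo)).add
    (hasSum_ite_eq s.complete ((s.busyServers : ℝ) * mu))).tsum_eq

/-- Each state has finitely many predecessors. The alternative `s.busyServers = 0` discards the
fictitious completion that maps the empty system to itself at rate zero. -/
theorem balance_finset (hP : IsSteadyState (npRate lamHi lamLo mu) P) (t : NPState N)
    (A : Finset (NPState N))
    (hA : ∀ s ∉ A, t ≠ s.arriveHi ∧ t ≠ s.arriveLo ∧ (s.busyServers = 0 ∨ t ≠ s.complete)) :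
    P t * (lamHi + lamLo + t.busyServers * mu) = ∑ s ∈ A, P s * npRate lamHi lamLo mu s t := by
  rw [← tsum_npRate]
  refine (hP.balance t).unique (hasSum_sum_of_ne_finset_zero fun s hs => ?_)
  obtain ⟨h1, h2, h3⟩ := hA s hs
  rcases h3 with h3 | h3 <;> simp [npRate, h1, h2, h3]

theorem balance_busy_succ_succ (hP : IsSteadyState (npRate lamHi lamLo mu) P) (n m : ℕ) :
    P (busy (n + 1) (m + 1)) * (lamHi + lamLo + N * mu) = P (busy (n + 1) m) * lamHi
      + P (busy n (m + 1)) * lamLo + P (busy (n + 1) (m + 2)) * (N * mu) := by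
  have h := balance_finset hP (busy (n + 1) (m + 1))
    {busy (n + 1) m, busy n (m + 1), busy (n + 1) (m + 2)} (by
      rintro (k | ⟨_ | a, _ | b⟩) hs <;>
        simp [arriveHi, arriveLo, complete, busy_eq_occupy] at hs ⊢ <;> omega)
  cases m <;>
  simpa [npRate, arriveHi, arriveLo, complete, busyServers, add_assoc] using h

theorem balance_busy_zero_succ (hP : IsSteadyState (npRate lamHi lamLo mu) P) (m : ℕ) :
    P (busy 0 (m + 1)) * (lamHi + lamLo + N * mu) = P (busy 0 m) * lamHi
      + P (busy 0 (m + 2)) * (N * mu) := by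
  have h := balance_finset hP (busy 0 (m + 1)) {busy 0 m, busy 0 (m + 2)} (by
      rintro (k | ⟨_ | a, _ | b⟩) hs <;>
        simp [arriveHi, arriveLo, complete, busy_eq_occupy] at hs ⊢ <;> omega)
  cases m <;>
  simpa [npRate, arriveHi, arriveLo, complete, busyServers, add_assoc] using h

theorem balance_busy_succ_zero (hP : IsSteadyState (npRate lamHi lamLo mu) P) (n : ℕ) :
    P (busy (n + 1) 0) * (lamHi + lamLo + N * mu) = P (busy n 0) * lamLo
      + P (busy (n + 1) 1) * (N * mu) + P (busy (n + 2) 0) * (N * mu) := by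
  have h := balance_finset hP (busy (n + 1) 0) {busy n 0, busy (n + 1) 1, busy (n + 2) 0} (by
      rintro (k | ⟨_ | a, _ | b⟩) hs <;>
        simp [arriveHi, arriveLo, complete, busy_eq_occupy] at hs ⊢ <;> omega)
  cases n <;>
  simpa [npRate, arriveHi, arriveLo, complete, busyServers, add_assoc] using h

theorem balance_busy_zero_zero (hP : IsSteadyState (npRate lamHi lamLo mu) P) :
    P (busy 0 0) * (lamHi + lamLo + N * mu) = P (noWait N (N - 1)) * (lamHi + lamLo)
      + P (busy 0 1) * (N * mu) + P (busy 1 0) * (N * mu) := by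
  have hN : N - 1 < N := Nat.sub_lt (NeZero.pos N) Nat.one_pos
  have hN' : N - 1 + 1 = N := Nat.succ_pred_eq_of_pos (NeZero.pos N)
  rw [noWait_of_lt hN]
  have h := balance_finset hP (busy 0 0) {idle ⟨N - 1, hN⟩, busy 0 1, busy 1 0} (by
      rintro (k | ⟨_ | a, _ | b⟩) hs <;>
        simp [arriveHi, arriveLo, complete, busy_eq_occupy, Fin.ext_iff] at hs ⊢ <;> omega)
  simpa [npRate, arriveHi, arriveLo, complete, busyServers, add_assoc, busy_eq_occupy, hN'] using h

theorem balance_idle_zero (hP : IsSteadyState (npRate lamHi lamLo mu) P) :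
    P (noWait N 0) * (lamHi + lamLo) = P (noWait N 1) * mu := by
  have hN : 0 < N := NeZero.pos N
  rw [noWait_of_lt hN]
  by_cases h1 : 1 < N
  · rw [noWait_of_lt h1]
    have h := balance_finset hP (idle ⟨0, hN⟩) {idle ⟨1, h1⟩} (by
      rintro (k | ⟨_ | a, _ | b⟩) hs <;>
        simp [arriveHi, arriveLo, complete, idle_eq_occupy, Fin.ext_iff, busyServers, -Fin.val_eq_zero_iff] at hs ⊢ <;>
        omega)
    simpa [npRate, arriveHi, arriveLo, complete, busyServers, idle_eq_occupy] using h
  · obtain rfl : N = 1 := by omega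
    have h := balance_finset hP (idle ⟨0, hN⟩) {busy 0 0} (by
      rintro (k | ⟨_ | a, _ | b⟩) hs <;>
        simp [arriveHi, arriveLo, complete, idle_eq_occupy, busyServers, -Fin.val_eq_zero_iff] at hs ⊢)
    simpa [npRate, arriveHi, arriveLo, complete, busyServers, noWait_self] using h

theorem balance_idle_succ (hP : IsSteadyState (npRate lamHi lamLo mu) P) {k : ℕ}
    (hk : k + 1 < N) :
    P (noWait N (k + 1)) * (lamHi + lamLo + (k + 1) * mu) =
      P (noWait N k) * (lamHi + lamLo) + P (noWait N (k + 2)) * ((k + 2) * mu) := by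
  rw [noWait_of_lt hk, noWait_of_lt (Nat.lt_of_succ_lt hk)]
  -- Subtraction is truncated, so that a completion from `idle k` cannot lead up to `k + 1` has to
  -- be supplied.
  have hk' : k + 1 ≠ k - 1 := by omega
  by_cases h1 : k + 2 < N
  · rw [noWait_of_lt h1]
    have h := balance_finset hP (idle ⟨k + 1, hk⟩)
      {idle ⟨k, Nat.lt_of_succ_lt hk⟩, idle ⟨k + 2, h1⟩} (by
        rintro (j | ⟨_ | a, _ | b⟩) hs <;>
          simp [arriveHi, arriveLo, complete, idle_eq_occupy, Fin.ext_iff, busyServers, -Fin.val_eq_zero_iff] at hs ⊢ <;>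
          omega)
    simpa [npRate, arriveHi, arriveLo, complete, busyServers, add_assoc, idle_eq_occupy, hk']
      using h
  · obtain rfl : N = k + 2 := by omega
    have h := balance_finset hP (idle ⟨k + 1, hk⟩)
      {idle ⟨k, Nat.lt_of_succ_lt hk⟩, busy 0 0} (by
        rintro (j | ⟨_ | a, _ | b⟩) hs <;>
          simp [arriveHi, arriveLo, complete, idle_eq_occupy, Fin.ext_iff, busyServers, -Fin.val_eq_zero_iff] at hs ⊢ <;>
          omega)
    simpa [npRate, arriveHi, arriveLo, complete, busyServers, add_assoc, idle_eq_occupy, hk',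
      noWait_self] using h

/-- Flux balance across the cut between `k` and `k + 1` busy servers. -/
theorem cut_noWait (hP : IsSteadyState (npRate lamHi lamLo mu) P) {k : ℕ} (hk : k < N) :
    P (noWait N k) * (lamHi + lamLo) = P (noWait N (k + 1)) * ((k + 1) * mu) := by
  induction k with
  | zero => simpa using balance_idle_zero hP
  | succ k ih =>
    have h1 := ih (Nat.lt_of_succ_lt hk)
    have h2 := balance_idle_succ hP hk
    push_cast at *
    linear_combination h2 + h1

theorem cut_busy_zero_zero (hP : IsSteadyState (npRate lamHi lamLo mu) P) :
    P (busy 0 0) * (lamHi + lamLo) = P (busy 0 1) * (N * mu) + P (busy 1 0) * (N * mu) := by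
  have h1 := cut_noWait hP (Nat.sub_lt (NeZero.pos N) Nat.one_pos)
  have h2 := balance_busy_zero_zero hP
  have hN' : N - 1 + 1 = N := Nat.succ_pred_eq_of_pos (NeZero.pos N)
  have hN'' : ((N - 1 : ℕ) : ℝ) + 1 = N := by exact_mod_cast hN'
  rw [hN', hN'', noWait_self] at h1
  linear_combination h2 + h1

/-- In the steady state all servers are busy with positive probability. -/
theorem exists_busy_ne_zero (hP : IsSteadyState (npRate lamHi lamLo mu) P)
    (hlam : 0 < lamHi + lamLo) : ∃ n m, P (busy n m) ≠ 0 := by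
  by_contra! h
  -- If the busy states carry no mass, the cut equations propagate zero downwards from `N`, leaving
  -- total mass zero.
  have hz : ∀ j, j ≤ N → P (noWait N (N - j)) = 0 := by
    intro j
    induction j with
    | zero => intro _; rw [Nat.sub_zero, noWait_self]; exact h 0 0
    | succ j ih =>
      intro hj
      have h1 := cut_noWait hP (show N - (j + 1) < N by omega)
      rw [show N - (j + 1) + 1 = N - j by omega, ih (by omega), zero_mul] at h1
      exact (mul_eq_zero.1 h1).resolve_right hlam.ne'
  have h0 : P = fun _ => 0 := by
    funext s
    rcases s with k | ⟨n, m⟩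
    · have := hz (N - k) (by omega)
      rwa [Nat.sub_sub_self k.isLt.le, noWait_of_lt k.isLt] at this
    · exact h n m
  have := hP.total
  rw [h0] at this
  exact zero_ne_one (hasSum_zero.unique this)

end Balance

/-- A solution of `d (m + 2) - (a + b) * d (m + 1) + a * b * d m = 0` which tends to zero is
geometric with ratio `a` if `1 ≤ ‖b‖`. -/
theorem eq_pow_mul_of_recurrence {𝕜 : Type*} [NormedField 𝕜] {a b : 𝕜} (hb : 1 ≤ ‖b‖) {d : ℕ → 𝕜}
    (hd : ∀ m, d (m + 2) = (a + b) * d (m + 1) - a * b * d m) (h0 : Tendsto d atTop (𝓝 0)) (m : ℕ) :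
    d m = a ^ m * d 0 := by
  -- Removing the factor with root `a` leaves a geometric sequence of ratio `b`. It tends to zero
  -- without decreasing in norm, hence vanishes; `‖b‖ = 1` is allowed.
  have hD : ∀ m, d (m + 1) - a * d m = b ^ m * (d 1 - a * d 0) := by
    intro m
    induction m with
    | zero => simp
    | succ m ih => rw [hd]; rw [pow_succ]; linear_combination b * ih
  have hlim : Tendsto (fun m => ‖d (m + 1) - a * d m‖) atTop (𝓝 0) := by
    have h1 : Tendsto (fun m => d (m + 1)) atTop (𝓝 0) := (tendsto_add_atTop_iff_nat 1).2 h0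
    have h2 : Tendsto (fun m => a * d m) atTop (𝓝 (a * 0)) := h0.const_mul a
    have h3 : Tendsto (fun m => ‖d (m + 1) - a * d m‖) atTop (𝓝 ‖0 - a * 0‖) := (h1.sub h2).norm
    simpa using h3
  have hle : ‖d 1 - a * d 0‖ ≤ 0 := by
    refine ge_of_tendsto' hlim fun m => ?_
    rw [hD m, norm_mul, norm_pow]
    exact le_mul_of_one_le_left (norm_nonneg _) (one_le_pow₀ hb)
  have h10 : d 1 - a * d 0 = 0 := norm_le_zero_iff.1 hle
  induction m with
  | zero => simp
  | succ m ih =>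
    have := hD m
    rw [h10, mul_zero, sub_eq_zero] at this
    rw [this, ih, pow_succ]; ring

/-- Balance equations and normalisation of the joint distribution of the numbers of waiting
clients, given that all servers are busy. -/
structure WaitBalance (r₁ r₂ : ℝ) (f : ℕ → ℕ → ℝ) : Prop where
  nonneg : ∀ n m, 0 ≤ f n m
  total : HasSum (fun x : ℕ × ℕ => f x.1 x.2) 1
  zero_zero : (r₁ + r₂) * f 0 0 = f 0 1 + f 1 0
  zero_succ : ∀ m, (1 + r₁ + r₂) * f 0 (m + 1) = r₁ * f 0 m + f 0 (m + 2)
  succ_zero : ∀ n, (1 + r₁ + r₂) * f (n + 1) 0 = r₂ * f n 0 + f (n + 1) 1 + f (n + 2) 0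
  succ_succ : ∀ n m, (1 + r₁ + r₂) * f (n + 1) (m + 1) =
    r₁ * f (n + 1) m + r₂ * f n (m + 1) + f (n + 1) (m + 2)

/-! ### The characteristic roots. -/

section Roots

variable {r r₁ r₂ p : ℝ}

/-- At `1` the quadratic takes the value `-r₂ * (1 - p) ≤ 0`, so its roots are real and `1` lies
between them. -/
theorem cohen_disc_nonneg (hr : r = r₁ + r₂) (hr_lt : r < 1) (h2 : 0 ≤ r₂) (hp : p ≤ 1) :
    0 ≤ (1 + r - r₂ * p) ^ 2 - 4 * r₁ := by
  nlinarith [mul_nonneg h2 (sub_nonneg.2 hp), sq_nonneg (1 - r₁)]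

theorem cohenLam_add : cohenLam1 r r₁ r₂ p + cohenLam2 r r₁ r₂ p = 1 + r - r₂ * p := by
  unfold cohenLam1 cohenLam2; ring

theorem cohenLam_mul (h : 0 ≤ (1 + r - r₂ * p) ^ 2 - 4 * r₁) :
    cohenLam1 r r₁ r₂ p * cohenLam2 r r₁ r₂ p = r₁ := by
  unfold cohenLam1 cohenLam2
  linear_combination (-1 / 4) * Real.sq_sqrt h

theorem cohenLam1_le_cohenLam2 : cohenLam1 r r₁ r₂ p ≤ cohenLam2 r r₁ r₂ p := by
  unfold cohenLam1 cohenLam2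
  have := Real.sqrt_nonneg ((1 + r - r₂ * p) ^ 2 - 4 * r₁)
  linarith

theorem one_le_cohenLam2 (hr : r = r₁ + r₂) (hr_lt : r < 1) (h2 : 0 ≤ r₂) (hp : p ≤ 1) :
    1 ≤ cohenLam2 r r₁ r₂ p := by
  have hd := cohen_disc_nonneg hr hr_lt h2 hp
  have ha := cohenLam_add (r := r) (r₁ := r₁) (r₂ := r₂) (p := p)
  have hm := cohenLam_mul hd
  have hle := cohenLam1_le_cohenLam2 (r := r) (r₁ := r₁) (r₂ := r₂) (p := p)
  by_contra! h
  nlinarith [mul_pos (sub_pos.2 h) (sub_pos.2 (lt_of_le_of_lt hle h)),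
    mul_nonneg h2 (sub_nonneg.2 hp)]

theorem cohenLam1_pos (h1 : 0 < r₁) (hr : r = r₁ + r₂) (hr_lt : r < 1) (h2 : 0 ≤ r₂)
    (hp : p ≤ 1) : 0 < cohenLam1 r r₁ r₂ p := by
  have hd := cohen_disc_nonneg hr hr_lt h2 hp
  have hm := cohenLam_mul hd
  have := one_le_cohenLam2 hr hr_lt h2 hp
  by_contra! h
  nlinarith

theorem cohenLam1_lt_one (h1 : 0 < r₁) (hr : r = r₁ + r₂) (hr_lt : r < 1) (h2 : 0 ≤ r₂)
    (hp : p ≤ 1) : cohenLam1 r r₁ r₂ p < 1 := by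
  have hd := cohen_disc_nonneg hr hr_lt h2 hp
  have hm := cohenLam_mul hd
  have := one_le_cohenLam2 hr hr_lt h2 hp
  have := cohenLam1_pos h1 hr hr_lt h2 hp
  nlinarith

theorem cohenLam_mul_one_sub (hr : r = r₁ + r₂) (hr_lt : r < 1) (h2 : 0 ≤ r₂) (hp : p ≤ 1) :
    (1 - p * cohenLam1 r r₁ r₂ p) * (1 - p * cohenLam2 r r₁ r₂ p) = (1 - p) * (1 - r * p) := by
  have hm := cohenLam_mul (cohen_disc_nonneg hr hr_lt h2 hp)
  have ha := cohenLam_add (r := r) (r₁ := r₁) (r₂ := r₂) (p := p)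
  linear_combination (-p) * ha + p ^ 2 * hm - p ^ 2 * hr

theorem one_sub_mul_cohenLam2_pos (h1 : 0 < r₁) (hr : r = r₁ + r₂) (hr_lt : r < 1) (h2 : 0 ≤ r₂)
    (hp0 : 0 ≤ p) (hp : p < 1) : 0 < 1 - p * cohenLam2 r r₁ r₂ p := by
  have h := cohenLam_mul_one_sub hr hr_lt h2 hp.le
  have hl := cohenLam1_lt_one h1 hr hr_lt h2 hp.le
  have hl0 := cohenLam1_pos h1 hr hr_lt h2 hp.le
  have : 0 < 1 - p * cohenLam1 r r₁ r₂ p := by nlinarith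
  refine pos_of_mul_pos_right (a := 1 - p * cohenLam1 r r₁ r₂ p) ?_ this.le
  rw [h]
  exact mul_pos (by linarith) (by nlinarith)

end Roots

/-! ### Generating functions of the waiting distribution. -/

namespace WaitBalance

variable {r r₁ r₂ : ℝ} {f : ℕ → ℕ → ℝ}

theorem summable_low (hf : WaitBalance r₁ r₂ f) (m : ℕ) : Summable fun n => f n m :=
  hf.total.summable.comp_injective (Prod.mk_left_injective m)

theorem summable_high (hf : WaitBalance r₁ r₂ f) (n : ℕ) : Summable fun m => f n m :=
  hf.total.summable.comp_injective (Prod.mk_right_injective n)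

theorem pow_mul_le (hf : WaitBalance r₁ r₂ f) {p : ℝ} (hp0 : 0 ≤ p) (hp : p ≤ 1) (k n m : ℕ) :
    ‖p ^ k * f n m‖ ≤ f n m := by
  rw [Real.norm_of_nonneg (mul_nonneg (pow_nonneg hp0 _) (hf.nonneg n m))]
  exact mul_le_of_le_one_left (hf.nonneg n m) (pow_le_one₀ hp0 hp)

theorem summable_pow_mul (hf : WaitBalance r₁ r₂ f) {p : ℝ} (hp0 : 0 ≤ p) (hp : p ≤ 1) :
    Summable fun x : ℕ × ℕ => p ^ x.1 * f x.1 x.2 :=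
  Summable.of_norm_bounded hf.total.summable fun _ => hf.pow_mul_le hp0 hp _ _ _

theorem summable_pow_mul_low (hf : WaitBalance r₁ r₂ f) {p : ℝ} (hp0 : 0 ≤ p) (hp : p ≤ 1)
    (j m : ℕ) : Summable fun n => p ^ n * f (n + j) m :=
  Summable.of_norm_bounded ((summable_nat_add_iff j).2 (hf.summable_low m))
    fun _ => hf.pow_mul_le hp0 hp _ _ _

/-- The generating function of the low-priority count, for a fixed high-priority count. -/
noncomputable def _root_.lowGen (f : ℕ → ℕ → ℝ) (p : ℝ) (m : ℕ) : ℝ := ∑' n, p ^ n * f n m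

theorem hasSum_lowGen (hf : WaitBalance r₁ r₂ f) {p : ℝ} (hp0 : 0 ≤ p) (hp : p ≤ 1) (m : ℕ) :
    HasSum (fun n => p ^ n * f n m) (lowGen f p m) :=
  (hf.summable_pow_mul_low hp0 hp 0 m).hasSum

theorem tsum_low_eq (hf : WaitBalance r₁ r₂ f) {p : ℝ} (hp0 : 0 ≤ p) (hp : p ≤ 1) (j m : ℕ) :
    ∑' n, p ^ n * f (n + j) m = f j m + p * ∑' n, p ^ n * f (n + (j + 1)) m := by
  rw [(hf.summable_pow_mul_low hp0 hp j m).tsum_eq_zero_add, ← tsum_mul_left]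
  simp only [pow_zero, one_mul, zero_add, pow_succ', mul_assoc]
  simp only [add_assoc, add_comm 1]

theorem lowGen_succ_succ (hf : WaitBalance r₁ r₂ f) {p : ℝ} (hp0 : 0 ≤ p) (hp : p ≤ 1) (m : ℕ) :
    lowGen f p (m + 2) = (1 + r₁ + r₂ - r₂ * p) * lowGen f p (m + 1) - r₁ * lowGen f p m := by
  have hs := fun j m => (hf.summable_pow_mul_low hp0 hp j m).hasSum
  have h1 : (1 + r₁ + r₂) * ∑' n, p ^ n * f (n + 1) (m + 1) =
      r₁ * ∑' n, p ^ n * f (n + 1) m + r₂ * ∑' n, p ^ n * f (n + 0) (m + 1)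
        + ∑' n, p ^ n * f (n + 1) (m + 2) := by
    refine ((hs 1 (m + 1)).mul_left (1 + r₁ + r₂)).unique ?_
    convert (((hs 1 m).mul_left r₁).add ((hs 0 (m + 1)).mul_left r₂)).add (hs 1 (m + 2)) using 2
      with n
    linear_combination p ^ n * hf.succ_succ n m
  have e0 := hf.tsum_low_eq hp0 hp 0 m
  have e1 := hf.tsum_low_eq hp0 hp 0 (m + 1)
  have e2 := hf.tsum_low_eq hp0 hp 0 (m + 2)
  have h0 := hf.zero_succ m
  simp only [add_zero, zero_add] at e0 e1 e2 h1
  unfold lowGen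
  linear_combination e2 - (1 + r₁ + r₂) * e1 + r₁ * e0 - h0 - p * h1

/-- The term `f (n + 2) 0`, a low-priority client entering service, shifts the series down by one;
the overall factor `p` avoids dividing by `p`. -/
theorem lowGen_zero_mul (hf : WaitBalance r₁ r₂ f) {p : ℝ} (hp0 : 0 ≤ p) (hp : p ≤ 1) :
    p * ((1 + r₁ + r₂ - r₂ * p) * lowGen f p 0) =
      p * f 0 0 + p * lowGen f p 1 + (lowGen f p 0 - f 0 0) := by
  have hs := fun j m => (hf.summable_pow_mul_low hp0 hp j m).hasSum
  have h1 : (1 + r₁ + r₂) * ∑' n, p ^ n * f (n + 1) 0 =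
      r₂ * ∑' n, p ^ n * f (n + 0) 0 + ∑' n, p ^ n * f (n + 1) 1 + ∑' n, p ^ n * f (n + 2) 0 := by
    refine ((hs 1 0).mul_left (1 + r₁ + r₂)).unique ?_
    convert (((hs 0 0).mul_left r₂).add (hs 1 1)).add (hs 2 0) using 2 with n
    linear_combination p ^ n * hf.succ_zero n
  have e0 := hf.tsum_low_eq hp0 hp 0 0
  have e1 := hf.tsum_low_eq hp0 hp 0 1
  have e2 := hf.tsum_low_eq hp0 hp 1 0
  have h0 := hf.zero_zero
  simp only [add_zero, zero_add, one_add_one_eq_two] at e0 e1 e2 h1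
  unfold lowGen
  linear_combination (p * (1 + r₁ + r₂) - 1) * e0 - p * e1 + p * h0 + p * p * h1 - p * e2

theorem lowGen_eq_pow_mul (hf : WaitBalance r₁ r₂ f) (hr : r = r₁ + r₂) (hr_lt : r < 1)
    (h2 : 0 ≤ r₂) {p : ℝ} (hp0 : 0 ≤ p) (hp : p ≤ 1) (m : ℕ) :
    lowGen f p m = cohenLam1 r r₁ r₂ p ^ m * lowGen f p 0 := by
  refine eq_pow_mul_of_recurrence (b := cohenLam2 r r₁ r₂ p) ?_ (fun m => ?_) ?_ m
  · exact (one_le_cohenLam2 hr hr_lt h2 hp).trans (le_abs_self _)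
  · rw [cohenLam_add, cohenLam_mul (cohen_disc_nonneg hr hr_lt h2 hp), hf.lowGen_succ_succ hp0 hp,
      hr]
    ring
  -- Summing over `n` first shows that `lowGen f p` is summable in `m`, hence tends to zero.
  · have h := ((Equiv.prodComm ℕ ℕ).summable_iff.2 (hf.summable_pow_mul hp0 hp)).prod
    exact h.tendsto_atTop_zero

theorem lowGen_zero_mul_one_sub (hf : WaitBalance r₁ r₂ f) (hr : r = r₁ + r₂) (hr_lt : r < 1)
    (h2 : 0 ≤ r₂) {p : ℝ} (hp0 : 0 ≤ p) (hp : p ≤ 1) :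
    lowGen f p 0 * (1 - p * cohenLam2 r r₁ r₂ p) = f 0 0 * (1 - p) := by
  have h := hf.lowGen_zero_mul hp0 hp
  have h1 := hf.lowGen_eq_pow_mul hr hr_lt h2 hp0 hp 1
  have ha := cohenLam_add (r := r) (r₁ := r₁) (r₂ := r₂) (p := p)
  rw [h1] at h
  linear_combination -h - p * lowGen f p 0 * ha - p * lowGen f p 0 * hr

/-- The factor `(1 - p) / (1 - p * λ₂)` becomes `0 / 0` at `p = 1`. By `cohenLam_mul_one_sub` it
equals `(1 - p * λ₁) / (1 - r * p)`, which is continuous there. -/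
theorem tsum_pow_mul (hf : WaitBalance r₁ r₂ f) (h1 : 0 < r₁) (hr : r = r₁ + r₂) (hr_lt : r < 1)
    (h2 : 0 ≤ r₂) {p : ℝ} (hp0 : 0 ≤ p) (hp : p < 1) :
    ∑' x : ℕ × ℕ, p ^ x.1 * f x.1 x.2 =
      f 0 0 * (1 - p * cohenLam1 r r₁ r₂ p) / (1 - r * p) / (1 - cohenLam1 r r₁ r₂ p) := by
  have hs := (Equiv.prodComm ℕ ℕ).summable_iff.2 (hf.summable_pow_mul hp0 hp.le)
  have hL := one_sub_mul_cohenLam2_pos h1 hr hr_lt h2 hp0 hp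
  have h01 := cohenLam_mul_one_sub hr hr_lt h2 hp.le
  have hlt := cohenLam1_lt_one h1 hr hr_lt h2 hp.le
  have hpos := cohenLam1_pos h1 hr hr_lt h2 hp.le
  have hrp : 0 < 1 - r * p := by nlinarith
  have hG : lowGen f p 0 = f 0 0 * (1 - p * cohenLam1 r r₁ r₂ p) / (1 - r * p) := by
    rw [eq_div_iff hrp.ne']
    refine mul_right_cancel₀ hL.ne' ?_
    have := hf.lowGen_zero_mul_one_sub hr hr_lt h2 hp0 hp.le
    linear_combination (1 - r * p) * this - f 0 0 * h01
  rw [← (Equiv.prodComm ℕ ℕ).tsum_eq]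
  refine hs.tsum_prod.trans ?_
  change ∑' m, lowGen f p m = _
  rw [tsum_congr (hf.lowGen_eq_pow_mul hr hr_lt h2 hp0 hp.le), tsum_mul_right, tsum_geometric_of_lt_one hpos.le hlt, hG, inv_mul_eq_div]

/-- The probability that nobody waits, given that all servers are busy. -/
theorem zero_zero_eq (hf : WaitBalance r₁ r₂ f) (h1 : 0 < r₁) (hr : r = r₁ + r₂) (hr_lt : r < 1)
    (h2 : 0 ≤ r₂) : f 0 0 = 1 - r := by
  have hmem : ∀ᶠ p in 𝓝[<] (1 : ℝ), p ∈ Set.Ico (0 : ℝ) 1 := Ico_mem_nhdsLT one_pos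
  have hA : Tendsto (fun p : ℝ => ∑' x : ℕ × ℕ, p ^ x.1 * f x.1 x.2) (𝓝[<] 1) (𝓝 1) := by
    rw [show 𝓝 (1 : ℝ) = 𝓝 (∑' x : ℕ × ℕ, f x.1 x.2) by rw [hf.total.tsum_eq]]
    refine tendsto_tsum_of_dominated_convergence hf.total.summable (fun x => ?_) ?_
    · have : Continuous fun p : ℝ => p ^ x.1 * f x.1 x.2 := by fun_prop
      simpa using (this.tendsto 1).mono_left nhdsWithin_le_nhds
    · filter_upwards [hmem] with p hp x using hf.pow_mul_le hp.1 hp.2.le _ _ _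
  have hl : cohenLam1 r r₁ r₂ 1 = r₁ := by
    have : (1 + r - r₂ * 1) ^ 2 - 4 * r₁ = (1 - r₁) ^ 2 := by rw [hr]; ring
    rw [cohenLam1, this, Real.sqrt_sq (by linarith), hr]
    ring
  have hB : Tendsto (fun p : ℝ => f 0 0 * (1 - p * cohenLam1 r r₁ r₂ p) / (1 - r * p)
      / (1 - cohenLam1 r r₁ r₂ p)) (𝓝[<] 1) (𝓝 (f 0 0 / (1 - r))) := by
    have hr1 : 1 - r ≠ 0 := by linarith
    have hr2 : 1 - r₁ ≠ 0 := by linarith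
    have hc : ContinuousAt (fun p : ℝ => f 0 0 * (1 - p * cohenLam1 r r₁ r₂ p) / (1 - r * p)
      / (1 - cohenLam1 r r₁ r₂ p)) 1 := by
      have : Continuous fun p => cohenLam1 r r₁ r₂ p := by unfold cohenLam1; fun_prop
      refine ContinuousAt.div (ContinuousAt.div (by fun_prop) (by fun_prop) (by simpa using hr1))
        (by fun_prop) (by rwa [hl])
    have := hc.tendsto.mono_left (nhdsWithin_le_nhds (s := Set.Iio 1))
    convert this using 2
    rw [hl]
    field_simp
  have hE := tendsto_nhds_unique (hA.congr' (by
    filter_upwards [hmem] with p hp using hf.tsum_pow_mul h1 hr hr_lt h2 hp.1 hp.2)) hB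
  rw [eq_div_iff (by linarith)] at hE
  linarith

theorem lowGen_eq (hf : WaitBalance r₁ r₂ f) (h1 : 0 < r₁) (hr : r = r₁ + r₂) (hr_lt : r < 1)
    (h2 : 0 ≤ r₂) {p : ℝ} (hp0 : 0 ≤ p) (hp : p < 1) (m : ℕ) :
    lowGen f p m = (1 - r) * (1 - p) / (1 - p * cohenLam2 r r₁ r₂ p) * cohenLam1 r r₁ r₂ p ^ m := by
  rw [hf.lowGen_eq_pow_mul hr hr_lt h2 hp0 hp.le, mul_comm, ← hf.zero_zero_eq h1 hr hr_lt h2,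
    ← hf.lowGen_zero_mul_one_sub hr hr_lt h2 hp0 hp.le,
    mul_div_cancel_right₀ _ (one_sub_mul_cohenLam2_pos h1 hr hr_lt h2 hp0 hp).ne']

end WaitBalance

/-! ### Moments along a contour and their decay. -/

theorem summable_norm_of_recurrence {a : ℂ} (ha : ‖a‖ < 1) {x y : ℕ → ℂ}
    (hx : ∀ m, x (m + 1) = a * x m + y m) (hy : Summable fun m => ‖y m‖) :
    Summable fun m => ‖x m‖ := by
  refine summable_of_sum_range_le (c := (‖x 0‖ + ∑' m, ‖y m‖) / (1 - ‖a‖))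
    (fun _ => norm_nonneg _) fun n => ?_
  rw [le_div_iff₀ (sub_pos.2 ha)]
  have h1 : ∑ m ∈ Finset.range n, ‖x (m + 1)‖ ≤
      ‖a‖ * ∑ m ∈ Finset.range n, ‖x m‖ + ∑' m, ‖y m‖ := by
    calc ∑ m ∈ Finset.range n, ‖x (m + 1)‖
        ≤ ∑ m ∈ Finset.range n, (‖a‖ * ‖x m‖ + ‖y m‖) := by
          refine Finset.sum_le_sum fun m _ => ?_
          rw [hx, ← norm_mul]
          exact norm_add_le _ _
      _ ≤ _ := by
          rw [Finset.sum_add_distrib, ← Finset.mul_sum]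
          gcongr
          exact hy.sum_le_tsum _ fun _ _ => norm_nonneg _
  have h2 := Finset.sum_range_succ (fun m => ‖x m‖) n
  rw [Finset.sum_range_succ'] at h2
  have := norm_nonneg (x n)
  linarith

/-- The contour integral of `z ^ m * g z`, divided by `2 π i`. -/
noncomputable def contourMoment (γ : ℝ → ℂ) (g : ℂ → ℂ) (m : ℕ) : ℂ :=
  contourInt γ (fun z => z ^ m * g z)

/-- Write `z = a + (z - a)`: raising the moment by one costs a factor `a` plus a moment with one
pole factor fewer. -/
theorem contourMoment_inv_sub_mul_succ {γ : ℝ → ℂ} (hγ : IsClosedContour γ) {a : ℂ}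
    (ha : ∀ z ∈ γ '' Set.Icc 0 1, z - a ≠ 0) {h : ℂ → ℂ}
    (hh : ContinuousOn h (γ '' Set.Icc 0 1)) (m : ℕ) :
    contourMoment γ (fun z => (z - a)⁻¹ * h z) (m + 1) =
      a * contourMoment γ (fun z => (z - a)⁻¹ * h z) m + contourMoment γ h m := by
  have hi : ContinuousOn (fun z => (z - a)⁻¹) (γ '' Set.Icc 0 1) :=
    ContinuousOn.inv₀ (by fun_prop) ha
  unfold contourMoment
  rw [← contourInt_const_mul, ← contourInt_add hγ (by fun_prop) (by fun_prop)]
  refine contourInt_congr fun z hz => ?_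
  have := ha z hz
  simp only
  field_simp
  ring

namespace IsRContour

variable {z₀ z₁ z₂ : ℂ} {γ : ℝ → ℂ}

theorem sub_ne_zero₀ (h : IsRContour z₀ z₁ z₂ γ) : ∀ z ∈ γ '' Set.Icc 0 1, z - z₀ ≠ 0 := by
  rintro _ ⟨t, ht, rfl⟩
  exact sub_ne_zero.2 (h.avoids t ht).1

theorem sub_ne_zero₁ (h : IsRContour z₀ z₁ z₂ γ) : ∀ z ∈ γ '' Set.Icc 0 1, z - z₁ ≠ 0 := by
  rintro _ ⟨t, ht, rfl⟩
  exact sub_ne_zero.2 (h.avoids t ht).2.1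

theorem sub_ne_zero₂ (h : IsRContour z₀ z₁ z₂ γ) : ∀ z ∈ γ '' Set.Icc 0 1, z - z₂ ≠ 0 := by
  rintro _ ⟨t, ht, rfl⟩
  exact sub_ne_zero.2 (h.avoids t ht).2.2

theorem continuousOn_inv₀ (h : IsRContour z₀ z₁ z₂ γ) :
    ContinuousOn (fun z => (z - z₀)⁻¹) (γ '' Set.Icc 0 1) :=
  ContinuousOn.inv₀ (by fun_prop) h.sub_ne_zero₀

theorem continuousOn_inv₁ (h : IsRContour z₀ z₁ z₂ γ) :
    ContinuousOn (fun z => (z - z₁)⁻¹) (γ '' Set.Icc 0 1) :=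
  ContinuousOn.inv₀ (by fun_prop) h.sub_ne_zero₁

theorem continuousOn_inv₂ (h : IsRContour z₀ z₁ z₂ γ) :
    ContinuousOn (fun z => (z - z₂)⁻¹) (γ '' Set.Icc 0 1) :=
  ContinuousOn.inv₀ (by fun_prop) h.sub_ne_zero₂

theorem ne₁₀ (h : IsRContour z₀ z₁ z₂ γ) : z₁ - z₀ ≠ 0 := fun e => by
  have := h.encloses
  rw [sub_eq_zero.1 e, h.exterior₀] at this
  exact zero_ne_one this

theorem ne₁₂ (h : IsRContour z₀ z₁ z₂ γ) : z₁ - z₂ ≠ 0 := fun e => by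
  have := h.encloses
  rw [sub_eq_zero.1 e, h.exterior₂] at this
  exact zero_ne_one this

theorem contourInt_inv_pow₂ (h : IsRContour z₀ z₁ z₂ γ) (b : ℕ) :
    contourInt γ (fun z => (z - z₂)⁻¹ ^ b) = 0 := by
  match b with
  | 0 => simpa using contourInt_pow h.contour 0
  | 1 => simpa [windingNo] using h.exterior₂
  | b + 2 =>
    simpa using contourInt_inv_pow h.contour (fun hm => h.sub_ne_zero₂ _ hm (sub_self _)) b

theorem contourInt_inv_mul_inv_pow (h : IsRContour z₀ z₁ z₂ γ) (b : ℕ) :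
    contourInt γ (fun z => (z - z₀)⁻¹ * (z - z₂)⁻¹ ^ b) = 0 := by
  have c0 := h.continuousOn_inv₀
  have c2 := h.continuousOn_inv₂
  -- The two points do coincide when `r₂ = 0`, and then partial fractions are unavailable.
  by_cases e : z₀ = z₂
  · subst e
    simpa [pow_succ'] using h.contourInt_inv_pow₂ (b + 1)
  · have e' : z₀ - z₂ ≠ 0 := sub_ne_zero.2 e
    induction b with
    | zero => simpa [windingNo] using h.exterior₀
    | succ b ih =>
      have : contourInt γ (fun z => (z - z₀)⁻¹ * (z - z₂)⁻¹ ^ (b + 1)) =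
          contourInt γ (fun z => (z₀ - z₂)⁻¹ *
            ((z - z₀)⁻¹ * (z - z₂)⁻¹ ^ b - (z - z₂)⁻¹ ^ (b + 1))) := by
        refine contourInt_congr fun z hz => ?_
        have h0 := h.sub_ne_zero₀ z hz
        have h2 := h.sub_ne_zero₂ z hz
        simp only [pow_succ]
        field_simp
        ring
      rw [this, contourInt_const_mul, contourInt_sub h.contour (by fun_prop) (by fun_prop), ih,
        h.contourInt_inv_pow₂]
      simp

theorem contourMoment_inv_pow₂ (h : IsRContour z₀ z₁ z₂ γ) (b m : ℕ) :
    contourMoment γ (fun z => (z - z₂)⁻¹ ^ b) m = 0 := by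
  have c2 := h.continuousOn_inv₂
  induction b generalizing m with
  | zero => simpa [contourMoment] using contourInt_pow h.contour m
  | succ b ihb =>
    induction m with
    | zero => simpa [contourMoment] using h.contourInt_inv_pow₂ (b + 1)
    | succ m ihm =>
      simp only [pow_succ'] at ihm ⊢
      rw [contourMoment_inv_sub_mul_succ h.contour h.sub_ne_zero₂ (by fun_prop), ihm, ihb]
      simp

theorem contourMoment_inv_mul_inv_pow (h : IsRContour z₀ z₁ z₂ γ) (b m : ℕ) :
    contourMoment γ (fun z => (z - z₀)⁻¹ * (z - z₂)⁻¹ ^ b) m = 0 := by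
  have c2 := h.continuousOn_inv₂
  induction m with
  | zero => simpa [contourMoment] using h.contourInt_inv_mul_inv_pow b
  | succ m ihm =>
    rw [contourMoment_inv_sub_mul_succ h.contour h.sub_ne_zero₀ (by fun_prop), ihm,
      h.contourMoment_inv_pow₂]
    simp

/-- The contour may leave the unit disc, so `z ^ m` gives no bound. Instead, induct on the order of
the pole at `z₁`: without it the moments vanish, and each added factor gives a recurrence of ratio
`z₁`. -/
theorem summable_contourMoment (h : IsRContour z₀ z₁ z₂ γ) (hz : ‖z₁‖ < 1) (a b : ℕ) :
    Summable fun m =>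
      ‖contourMoment γ (fun z => (z - z₁)⁻¹ ^ a * ((z - z₀)⁻¹ * (z - z₂)⁻¹ ^ b)) m‖ := by
  have c0 := h.continuousOn_inv₀
  have c1 := h.continuousOn_inv₁
  have c2 := h.continuousOn_inv₂
  induction a with
  | zero => simp only [pow_zero, one_mul, h.contourMoment_inv_mul_inv_pow, norm_zero, summable_zero]
  | succ a ih =>
    refine summable_norm_of_recurrence hz (fun m => ?_) ih
    simp only [pow_succ', mul_assoc]
    exact contourMoment_inv_sub_mul_succ h.contour h.sub_ne_zero₁ (by fun_prop) m

theorem rInt_eq_contourMoment (γ : ℝ → ℂ) (z₀ z₁ z₂ : ℂ) (m n : ℕ) : rInt γ z₀ z₁ z₂ m n =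
    contourMoment γ (fun z => (z - z₁)⁻¹ ^ n * ((z - z₀)⁻¹ * (z - z₂)⁻¹ ^ n)) m := by
  unfold rInt contourMoment
  congr 1
  funext z
  simp only [div_eq_mul_inv, mul_pow, mul_inv, inv_pow]
  ring

theorem tendsto_rInt (h : IsRContour z₀ z₁ z₂ γ) (hz : ‖z₁‖ < 1) (n : ℕ) :
    Tendsto (fun m => rInt γ z₀ z₁ z₂ m n) atTop (𝓝 0) := by
  simp only [rInt_eq_contourMoment]
  exact tendsto_zero_iff_norm_tendsto_zero.2 (h.summable_contourMoment hz n n).tendsto_atTop_zero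

theorem rInt_one (h : IsRContour z₀ z₁ z₂ γ) (m : ℕ) :
    rInt γ z₀ z₁ z₂ m 1 = z₁ ^ m / ((z₁ - z₀) * (z₁ - z₂)) := by
  have c0 := h.continuousOn_inv₀
  have c1 := h.continuousOn_inv₁
  have c2 := h.continuousOn_inv₂
  have n0 := h.ne₁₀
  have n2 := h.ne₁₂
  rw [rInt_eq_contourMoment]
  simp only [pow_one]
  induction m with
  | zero =>
    -- Partial fractions that never separate `z₀` from `z₂`, so `z₀ = z₂` remains allowed.
    have e : contourMoment γ (fun z => (z - z₁)⁻¹ * ((z - z₀)⁻¹ * (z - z₂)⁻¹)) 0 =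
        contourInt γ (fun z => ((z₁ - z₀)⁻¹ * (z₁ - z₂)⁻¹) * ((z - z₁)⁻¹ - (z - z₂)⁻¹)
          - (z₁ - z₀)⁻¹ * ((z - z₀)⁻¹ * (z - z₂)⁻¹ ^ 1)) := by
      refine contourInt_congr fun z hz => ?_
      have h0 := h.sub_ne_zero₀ z hz
      have h1 := h.sub_ne_zero₁ z hz
      have h2 := h.sub_ne_zero₂ z hz
      simp only [pow_zero, pow_one]
      field_simp
      ring
    have w1 : contourInt γ (fun z => (z - z₁)⁻¹) = 1 := h.encloses
    have w2 : contourInt γ (fun z => (z - z₂)⁻¹) = 0 := h.exterior₂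
    rw [e, contourInt_sub h.contour (by fun_prop) (by fun_prop), contourInt_const_mul,
      contourInt_const_mul, h.contourInt_inv_mul_inv_pow,
      contourInt_sub h.contour (by fun_prop) (by fun_prop), w1, w2]
    field_simp
    simp
  | succ m ih =>
    have := h.contourMoment_inv_mul_inv_pow 1 m
    simp only [pow_one] at this
    rw [contourMoment_inv_sub_mul_succ h.contour h.sub_ne_zero₁ (by fun_prop), ih, this, pow_succ']
    ring

theorem continuousOn_rInt (h : IsRContour z₀ z₁ z₂ γ) (m n : ℕ) :
    ContinuousOn (fun z => 1 / (z - z₀) * (z ^ m / ((z - z₁) * (z - z₂)) ^ n))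
      (γ '' Set.Icc 0 1) := by
  refine ContinuousOn.mul (ContinuousOn.div (by fun_prop) (by fun_prop) h.sub_ne_zero₀)
    (ContinuousOn.div (by fun_prop) (by fun_prop) fun z hz => pow_ne_zero _ ?_)
  exact mul_ne_zero (h.sub_ne_zero₁ z hz) (h.sub_ne_zero₂ z hz)

/-- Expand `z ^ m * (z - z₁) * (z - z₂)`; the product cancels one power in the denominator. -/
theorem rInt_recurrence (h : IsRContour z₀ z₁ z₂ γ) (m n : ℕ) :
    rInt γ z₀ z₁ z₂ (m + 2) (n + 1) = (z₁ + z₂) * rInt γ z₀ z₁ z₂ (m + 1) (n + 1)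
      - z₁ * z₂ * rInt γ z₀ z₁ z₂ m (n + 1) + rInt γ z₀ z₁ z₂ m n := by
  have c := h.continuousOn_rInt
  have c1 := c (m + 1) (n + 1)
  have c2 := c m (n + 1)
  unfold rInt
  rw [← contourInt_const_mul, ← contourInt_const_mul,
    ← contourInt_sub h.contour (by fun_prop) (by fun_prop),
    ← contourInt_add h.contour (by fun_prop) (c m n)]
  refine contourInt_congr fun z hz => ?_
  have h0 := h.sub_ne_zero₀ z hz
  have h1 := h.sub_ne_zero₁ z hz
  have h2 := h.sub_ne_zero₂ z hz
  simp only [pow_succ]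
  field_simp
  ring

end IsRContour

/-- The combination of R-integrals which gives the joint distribution, up to a factor depending
on the first index only. -/
noncomputable def jointInt (γ : ℝ → ℂ) (z₀ z₁ z₂ : ℂ) (m n : ℕ) : ℂ :=
  deltaRInt γ z₀ z₁ z₂ (m + 2) n - z₁ * z₂ * deltaRInt γ z₀ z₁ z₂ m n

/-! ### Recurrence and boundary identities for `jointInt`. -/

namespace IsRContour

variable {z₀ z₁ z₂ : ℂ} {γ : ℝ → ℂ}

theorem jointInt_recurrence (h : IsRContour z₀ z₁ z₂ γ) (m n : ℕ) :
    jointInt γ z₀ z₁ z₂ (m + 2) (n + 1) = (z₁ + z₂) * jointInt γ z₀ z₁ z₂ (m + 1) (n + 1)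
      - z₁ * z₂ * jointInt γ z₀ z₁ z₂ m (n + 1) + jointInt γ z₀ z₁ z₂ m n := by
  unfold jointInt deltaRInt
  linear_combination h.rInt_recurrence (m + 3) n - h.rInt_recurrence (m + 2) n
    - z₁ * z₂ * (h.rInt_recurrence (m + 1) n - h.rInt_recurrence m n)

theorem tendsto_jointInt (h : IsRContour z₀ z₁ z₂ γ) (hz : ‖z₁‖ < 1) (k n : ℕ) :
    Tendsto (fun m => jointInt γ z₀ z₁ z₂ (m + k) n) atTop (𝓝 0) := by
  have t := fun j => (tendsto_add_atTop_iff_nat (f := fun m => rInt γ z₀ z₁ z₂ m n) j).2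
    (h.tendsto_rInt hz n)
  have := ((t (k + 3)).sub (t (k + 2))).sub (((t (k + 1)).sub (t k)).const_mul (z₁ * z₂))
  simp only [sub_zero, mul_zero] at this
  exact this

theorem continuousOn_jointInt (h : IsRContour z₀ z₁ z₂ γ) (m n : ℕ) :
    ContinuousOn (fun z => (z - 1) * (z ^ 2 - z₁ * z₂) *
      (1 / (z - z₀) * (z ^ m / ((z - z₁) * (z - z₂)) ^ n))) (γ '' Set.Icc 0 1) := by
  have := h.continuousOn_rInt m n
  fun_prop

theorem jointInt_eq_contourInt (h : IsRContour z₀ z₁ z₂ γ) (m n : ℕ) :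
    jointInt γ z₀ z₁ z₂ m n = contourInt γ (fun z => (z - 1) * (z ^ 2 - z₁ * z₂) *
      (1 / (z - z₀) * (z ^ m / ((z - z₁) * (z - z₂)) ^ n))) := by
  have c0 := h.continuousOn_rInt m n
  have c1 := h.continuousOn_rInt (m + 1) n
  have c2 := h.continuousOn_rInt (m + 2) n
  have c3 := h.continuousOn_rInt (m + 2 + 1) n
  unfold jointInt deltaRInt rInt
  rw [← contourInt_sub h.contour c3 c2, ← contourInt_sub h.contour c1 c0, ← contourInt_const_mul,
    ← contourInt_sub h.contour (by fun_prop) (by fun_prop)]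
  congr 1
  funext z
  ring

theorem continuousOn_logDeriv_mul_pow (h : IsRContour z₀ z₁ z₂ γ) (k : ℕ) :
    ContinuousOn (fun z => (z ^ 2 - z₁ * z₂) / ((z - z₁) * (z - z₂)) ^ 2 *
      (z / ((z - z₁) * (z - z₂))) ^ k) (γ '' Set.Icc 0 1) := by
  have hne : ∀ z ∈ γ '' Set.Icc 0 1, (z - z₁) * (z - z₂) ≠ 0 := fun z hz =>
    mul_ne_zero (h.sub_ne_zero₁ z hz) (h.sub_ne_zero₂ z hz)
  exact ContinuousOn.mul (ContinuousOn.div (by fun_prop) (by fun_prop)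
    fun z hz => pow_ne_zero _ (hne z hz))
    (ContinuousOn.pow (ContinuousOn.div (by fun_prop) (by fun_prop) hne) k)

/-- The derivative of `z / Q` is `-(z² - z₁z₂) / Q²`, so the integrand is exact. -/
theorem contourInt_logDeriv_mul_pow (h : IsRContour z₀ z₁ z₂ γ) (k : ℕ) :
    contourInt γ (fun z => (z ^ 2 - z₁ * z₂) / ((z - z₁) * (z - z₂)) ^ 2 *
      (z / ((z - z₁) * (z - z₂))) ^ k) = 0 := by
  refine contourInt_eq_zero_of_hasDerivAt h.contour
    (F := fun z => -(z / ((z - z₁) * (z - z₂))) ^ (k + 1) / ((k + 1 : ℕ) : ℂ)) (fun z hz => ?_)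
    (h.continuousOn_logDeriv_mul_pow k)
  have hne := mul_ne_zero (h.sub_ne_zero₁ z hz) (h.sub_ne_zero₂ z hz)
  have hk : ((k + 1 : ℕ) : ℂ) ≠ 0 := by exact_mod_cast Nat.succ_ne_zero k
  have hQ : HasDerivAt (fun z : ℂ => (z - z₁) * (z - z₂)) (1 * (z - z₂) + (z - z₁) * 1) z :=
    ((hasDerivAt_id' z).sub_const z₁).mul ((hasDerivAt_id' z).sub_const z₂)
  have hv : HasDerivAt (fun z : ℂ => z / ((z - z₁) * (z - z₂)))
      ((1 * ((z - z₁) * (z - z₂)) - z * (1 * (z - z₂) + (z - z₁) * 1)) /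
        ((z - z₁) * (z - z₂)) ^ 2) z := (hasDerivAt_id' z).div hQ hne
  have hF : HasDerivAt (fun z : ℂ => -(z / ((z - z₁) * (z - z₂))) ^ (k + 1) / ((k + 1 : ℕ) : ℂ))
      _ z := ((hv.pow (k + 1)).neg).div_const _
  refine hF.congr_deriv ?_
  rw [Nat.add_sub_cancel, div_eq_iff hk]
  ring

theorem jointInt_boundary (h : IsRContour z₀ z₁ z₂ γ) {r : ℂ} (hs : z₁ + z₂ = 1 + r)
    (hp : z₁ * z₂ = r * z₀) (k : ℕ) :
    z₁ * z₂ * jointInt γ z₀ z₁ z₂ k (k + 2) +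
      (r - z₁ * z₂) * jointInt γ z₀ z₁ z₂ (k + 2) (k + 3) = 0 := by
  have c1 := h.continuousOn_jointInt k (k + 2)
  have c2 := h.continuousOn_jointInt (k + 2) (k + 3)
  have d1 := h.continuousOn_logDeriv_mul_pow k
  have d2 := h.continuousOn_logDeriv_mul_pow (k + 1)
  have key : r * contourInt γ (fun z => (z ^ 2 - z₁ * z₂) / ((z - z₁) * (z - z₂)) ^ 2 *
      (z / ((z - z₁) * (z - z₂))) ^ k) + r * (r - z₁ * z₂) * contourInt γ
      (fun z => (z ^ 2 - z₁ * z₂) / ((z - z₁) * (z - z₂)) ^ 2 *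
      (z / ((z - z₁) * (z - z₂))) ^ (k + 1)) = 0 := by
    rw [h.contourInt_logDeriv_mul_pow, h.contourInt_logDeriv_mul_pow]; ring
  rw [← key, h.jointInt_eq_contourInt, h.jointInt_eq_contourInt]
  simp only [← contourInt_const_mul]
  rw [← contourInt_add h.contour (by fun_prop) (by fun_prop),
    ← contourInt_add h.contour (by fun_prop) (by fun_prop)]
  refine contourInt_congr fun z hz => ?_
  have h0 := h.sub_ne_zero₀ z hz
  have hne := mul_ne_zero (h.sub_ne_zero₁ z hz) (h.sub_ne_zero₂ z hz)
  have hQ : (z - z₁) * (z - z₂) = z ^ 2 - (1 + r) * z + r * z₀ := by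
    linear_combination (-z) * hs + hp
  simp only [hQ, hp] at hne ⊢
  set Q := z ^ 2 - (1 + r) * z + r * z₀ with hQdef
  have e : (z - 1) * (z - r * z₀) = Q + (r - r * z₀) * z := by rw [hQdef]; ring
  -- This factorisation cancels the pole at `z₀`; `e` then splits the remainder into two exact
  -- terms.
  have e2 : r * z₀ * Q + (r - r * z₀) * z ^ 2 = r * (z - z₀) * (z - r * z₀) := by
    rw [hQdef]; ring
  clear_value Q
  have hI : 1 / (z - z₀) * (z - z₀) = 1 := one_div_mul_cancel h0
  set I := 1 / (z - z₀)
  have a1 : z ^ k / Q ^ (k + 2) = Q * (z ^ k / Q ^ (k + 3)) := by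
    rw [pow_succ Q (k + 2)]; field_simp
  have a2 : z ^ (k + 2) / Q ^ (k + 3) = z ^ 2 * (z ^ k / Q ^ (k + 3)) := by ring
  have a3 : (z ^ 2 - r * z₀) / Q ^ 2 * (z / Q) ^ k =
      (z ^ 2 - r * z₀) * (Q * (z ^ k / Q ^ (k + 3))) := by
    rw [← a1, div_pow, pow_add]; field_simp
  have a4 : (z ^ 2 - r * z₀) / Q ^ 2 * (z / Q) ^ (k + 1) =
      (z ^ 2 - r * z₀) * (z * (z ^ k / Q ^ (k + 3))) := by
    rw [div_pow, show k + 3 = 2 + (k + 1) by ring, pow_add Q 2]; field_simp; ring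
  rw [a1, a2, a3, a4]
  set p := z ^ k / Q ^ (k + 3)
  set w := z ^ 2 - r * z₀
  linear_combination (z - 1) * w * I * p * e2 + r * w * p * (z - 1) * (z - r * z₀) * hI
    + r * w * p * e

theorem jointInt_one (h : IsRContour z₀ z₁ z₂ γ) {r : ℂ} (hs : z₁ + z₂ = 1 + r)
    (hp : z₁ * z₂ = r * z₀) (m : ℕ) : jointInt γ z₀ z₁ z₂ m 1 = r * z₁ ^ m := by
  have n0 := h.ne₁₀
  have n2 := h.ne₁₂
  unfold jointInt deltaRInt
  simp only [h.rInt_one]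
  field_simp
  simp only [pow_succ]
  linear_combination z₁ ^ m * (z₁ - z₂) * (z₁ * hs - hp)

/-- This replaces the boundary identity at `k = -1`, where `z⁻¹` would bring in an uncontrolled pole
at `0`. The logarithmic derivative of `Q` contributes `r` through the winding numbers. -/
theorem jointInt_one_two (h : IsRContour z₀ z₁ z₂ γ) {r : ℂ} (hs : z₁ + z₂ = 1 + r)
    (hp : z₁ * z₂ = r * z₀) :
    (r - z₁ * z₂) * jointInt γ z₀ z₁ z₂ 1 2 = r * (z₁ - r) := by
  have i0 := h.continuousOn_inv₀
  have i1 := h.continuousOn_inv₁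
  have i2 := h.continuousOn_inv₂
  have c0 := h.continuousOn_jointInt 0 1
  have c1 := h.continuousOn_jointInt 1 1
  have c2 := h.continuousOn_jointInt 1 2
  have d := h.continuousOn_logDeriv_mul_pow 0
  have w0 : contourInt γ (fun z => (z - z₀)⁻¹) = 0 := h.exterior₀
  have w1 : contourInt γ (fun z => (z - z₁)⁻¹) = 1 := h.encloses
  have w2 : contourInt γ (fun z => (z - z₂)⁻¹) = 0 := h.exterior₂
  have p0 := contourInt_pow h.contour 0
  have p1 := contourInt_pow h.contour 1
  have j0 := h.jointInt_one hs hp 0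
  have j1 := h.jointInt_one hs hp 1
  have key : (r - z₁ * z₂) * jointInt γ z₀ z₁ z₂ 1 2 =
      jointInt γ z₀ z₁ z₂ 1 1 - (1 + r) * jointInt γ z₀ z₁ z₂ 0 1
      + (r * (r - z₁ * z₂)) * contourInt γ (fun z =>
        (z ^ 2 - z₁ * z₂) / ((z - z₁) * (z - z₂)) ^ 2 * (z / ((z - z₁) * (z - z₂))) ^ 0)
      - contourInt γ (fun z => z ^ 1) - (z₀ - 1) * contourInt γ (fun z => z ^ 0)
      - ((z₀ - 1) * (z₀ - r)) * contourInt γ (fun z => (z - z₀)⁻¹)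
      + r * contourInt γ (fun z => (z - z₁)⁻¹) + r * contourInt γ (fun z => (z - z₂)⁻¹) := by
    simp only [h.jointInt_eq_contourInt, ← contourInt_const_mul]
    rw [← contourInt_sub h.contour (by fun_prop) (by fun_prop),
      ← contourInt_add h.contour (by fun_prop) (by fun_prop),
      ← contourInt_sub h.contour (by fun_prop) (by fun_prop),
      ← contourInt_sub h.contour (by fun_prop) (by fun_prop),
      ← contourInt_sub h.contour (by fun_prop) (by fun_prop),
      ← contourInt_add h.contour (by fun_prop) (by fun_prop),
      ← contourInt_add h.contour (by fun_prop) (by fun_prop)]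
    refine contourInt_congr fun z hz => ?_
    have h0 := h.sub_ne_zero₀ z hz
    have h1 := h.sub_ne_zero₁ z hz
    have h2 := h.sub_ne_zero₂ z hz
    have hne := mul_ne_zero h1 h2
    have hQ : (z - z₁) * (z - z₂) = z ^ 2 - (1 + r) * z + r * z₀ := by
      linear_combination (-z) * hs + hp
    have hsum : r * (z - z₁)⁻¹ + r * (z - z₂)⁻¹ =
        r * (2 * z - (1 + r)) / ((z - z₁) * (z - z₂)) := by
      field_simp
      linear_combination -r * hs
    simp only [add_assoc _ (r * (z - z₁)⁻¹), hsum, hQ, hp] at hne ⊢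
    set Q := z ^ 2 - (1 + r) * z + r * z₀ with hQdef
    clear_value Q
    field_simp
    subst hQdef
    ring
  rw [key, j0, j1, h.contourInt_logDeriv_mul_pow, w0, w1, w2, p0, p1]
  ring

theorem tendsto_sum_jointInt (h : IsRContour z₀ z₁ z₂ γ) (hz : ‖z₁‖ < 1) (k n : ℕ) :
    Tendsto (fun M => ∑ m ∈ Finset.range M, jointInt γ z₀ z₁ z₂ (m + k) n) atTop
      (𝓝 (-(rInt γ z₀ z₁ z₂ (k + 2) n - z₁ * z₂ * rInt γ z₀ z₁ z₂ k n))) := by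
  have t := fun j => (tendsto_add_atTop_iff_nat (f := fun m => rInt γ z₀ z₁ z₂ m n) j).2
    (h.tendsto_rInt hz n)
  have hl := ((t (k + 2)).sub ((t k).const_mul (z₁ * z₂))).sub_const
    (rInt γ z₀ z₁ z₂ (k + 2) n - z₁ * z₂ * rInt γ z₀ z₁ z₂ k n)
  rw [mul_zero, sub_zero, zero_sub] at hl
  refine hl.congr fun M => ?_
  induction M with
  | zero => simp
  | succ M ih =>
    rw [Finset.sum_range_succ, ← ih, jointInt, deltaRInt, deltaRInt]
    simp only [show M + 1 + (k + 2) = M + k + 2 + 1 by ring, show M + (k + 2) = M + k + 2 by ring,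
      show M + 1 + k = M + k + 1 by ring]
    ring

end IsRContour

/-! ### Identification of the distribution with the integrals. -/

namespace WaitBalance

variable {r r₁ r₂ : ℝ} {f : ℕ → ℕ → ℝ} {z₀ z₁ z₂ : ℂ} {γ : ℝ → ℂ}

theorem zero_left_eq (hf : WaitBalance r₁ r₂ f) (h1 : 0 < r₁) (hr : r = r₁ + r₂) (hr_lt : r < 1)
    (h2 : 0 ≤ r₂) (m : ℕ) : f 0 m = (1 - r) * cohenLam1 r r₁ r₂ 0 ^ m := by
  have h := hf.lowGen_eq h1 hr hr_lt h2 le_rfl one_pos m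
  have h0 : lowGen f 0 m = f 0 m := by
    unfold lowGen
    rw [tsum_eq_single 0 fun n hn => by simp [hn]]
    simp
  rw [← h0, h]
  simp

theorem eq_jointInt_succ (hf : WaitBalance r₁ r₂ f) (hr : r = r₁ + r₂)
    (h : IsRContour z₀ z₁ z₂ γ) (hs : z₁ + z₂ = 1 + r) (hp : z₁ * z₂ = r₁) (hz₁ : ‖z₁‖ < 1)
    (hz₂ : 1 ≤ ‖z₂‖) {c : ℂ} {n : ℕ}
    (ih : ∀ m, (f n m : ℂ) = c * (-r₂) ^ n * jointInt γ z₀ z₁ z₂ (m + n) (n + 1))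
    (h0 : (f (n + 1) 0 : ℂ) = c * (-r₂) ^ (n + 1) * jointInt γ z₀ z₁ z₂ (0 + (n + 1)) (n + 2))
    (m : ℕ) :
    (f (n + 1) m : ℂ) = c * (-r₂) ^ (n + 1) * jointInt γ z₀ z₁ z₂ (m + (n + 1)) (n + 2) := by
  have hrec := eq_pow_mul_of_recurrence (a := z₁) (b := z₂) hz₂
    (d := fun m => (f (n + 1) m : ℂ) -
      c * (-r₂) ^ (n + 1) * jointInt γ z₀ z₁ z₂ (m + (n + 1)) (n + 2)) (fun m => ?_) ?_ m
  · simp only [h0, sub_self, mul_zero] at hrec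
    exact sub_eq_zero.1 hrec
  · have hJ := h.jointInt_recurrence (m + 1 + n) (n + 1)
    have hm := ih (m + 1)
    have hb : ((1 + r₁ + r₂ : ℝ) : ℂ) * f (n + 1) (m + 1) =
        r₁ * f (n + 1) m + r₂ * f n (m + 1) + f (n + 1) (m + 2) := by
      exact_mod_cast hf.succ_succ n m
    have hr' : (r : ℂ) = r₁ + r₂ := by exact_mod_cast hr
    simp only [show m + 2 + (n + 1) = m + 1 + n + 2 by ring,
      show m + 1 + (n + 1) = m + 1 + n + 1 by ring, show m + (n + 1) = m + 1 + n by ring]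
    push_cast at hb
    rw [hs, hp] at hJ ⊢
    linear_combination -hb - c * (-r₂) ^ (n + 1) * hJ - r₂ * hm - f (n + 1) (m + 1) * hr'
  · have t1 : Tendsto (fun m => (f (n + 1) m : ℂ)) atTop (𝓝 0) := by
      exact_mod_cast (Complex.continuous_ofReal.tendsto 0).comp
        (hf.summable_high (n + 1)).tendsto_atTop_zero
    simpa using t1.sub ((h.tendsto_jointInt hz₁ (n + 1) (n + 2)).const_mul (c * (-r₂) ^ (n + 1)))

/-- The joint distribution as a combination of R-integrals. -/
theorem eq_jointInt (hf : WaitBalance r₁ r₂ f) (h1 : 0 < r₁) (hr : r = r₁ + r₂) (hr_lt : r < 1)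
    (h2 : 0 ≤ r₂) (h : IsRContour z₀ z₁ z₂ γ) (hz₁ : z₁ = cohenLam1 r r₁ r₂ 0)
    (hz₂ : z₂ = cohenLam2 r r₁ r₂ 0) (hz₀ : z₀ = ((r₁ / r : ℝ) : ℂ)) (n m : ℕ) :
    (f n m : ℂ) = (1 - r) * (-r₂) ^ n / r * jointInt γ z₀ z₁ z₂ (m + n) (n + 1) := by
  have hr0 : r ≠ 0 := by linarith
  have hrC : (r : ℂ) ≠ 0 := by exact_mod_cast hr0
  have hr' : (r : ℂ) = r₁ + r₂ := by exact_mod_cast hr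
  have hs : z₁ + z₂ = 1 + r := by
    rw [hz₁, hz₂]
    have := cohenLam_add (r := r) (r₁ := r₁) (r₂ := r₂) (p := 0)
    rw [mul_zero, sub_zero] at this
    exact_mod_cast this
  have hp : z₁ * z₂ = r₁ := by
    rw [hz₁, hz₂]
    exact_mod_cast cohenLam_mul (cohen_disc_nonneg hr hr_lt h2 zero_le_one)
  have hp' : z₁ * z₂ = r * z₀ := by
    rw [hp, hz₀]
    push_cast
    field_simp
  have hn1 : ‖z₁‖ < 1 := by
    rw [hz₁, Complex.norm_real, Real.norm_of_nonneg (cohenLam1_pos h1 hr hr_lt h2 zero_le_one).le]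
    exact cohenLam1_lt_one h1 hr hr_lt h2 zero_le_one
  have hn2 : 1 ≤ ‖z₂‖ := by
    rw [hz₂, Complex.norm_real]
    exact (one_le_cohenLam2 hr hr_lt h2 zero_le_one).trans (le_abs_self _)
  have base : ∀ m, (f 0 m : ℂ) = (1 - r) * z₁ ^ m := by
    intro m
    rw [hf.zero_left_eq h1 hr hr_lt h2, hz₁]
    push_cast
    ring
  -- Two consecutive rows are carried, since the balance at `(n + 1, 0)` determines `f (n + 2) 0`
  -- from both.
  suffices H : ∀ n, (∀ m, (f n m : ℂ) =
        (1 - r) / r * (-r₂) ^ n * jointInt γ z₀ z₁ z₂ (m + n) (n + 1)) ∧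
      (∀ m, (f (n + 1) m : ℂ) =
        (1 - r) / r * (-r₂) ^ (n + 1) * jointInt γ z₀ z₁ z₂ (m + (n + 1)) (n + 2)) by
    rw [(H n).1 m]
    ring
  intro n
  induction n with
  | zero =>
    have H0 : ∀ m, (f 0 m : ℂ) =
        (1 - r) / r * (-r₂) ^ 0 * jointInt γ z₀ z₁ z₂ (m + 0) (0 + 1) := by
      intro m
      rw [base, add_zero, zero_add, h.jointInt_one hs hp']
      field_simp
    refine ⟨H0, hf.eq_jointInt_succ hr h hs hp hn1 hn2 H0 ?_⟩
    have hJ := h.jointInt_one_two hs hp'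
    have hb : ((r₁ : ℂ) + r₂) * f 0 0 = f 0 1 + f 1 0 := by exact_mod_cast hf.zero_zero
    rw [hp] at hJ
    rw [base, base] at hb
    simp only [zero_add, pow_one]
    rw [div_mul_eq_mul_div, div_mul_eq_mul_div, eq_div_iff hrC]
    linear_combination (-r) * hb + (1 - r) * hJ
      - (1 - r) * (r + jointInt γ z₀ z₁ z₂ 1 2) * hr'
  | succ n ih =>
    refine ⟨ih.2, hf.eq_jointInt_succ hr h hs hp hn1 hn2 ih.2 ?_⟩
    have hb : ((1 : ℂ) + r₁ + r₂) * f (n + 1) 0 = r₂ * f n 0 + f (n + 1) 1 + f (n + 2) 0 := by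
      exact_mod_cast hf.succ_zero n
    have hJ := h.jointInt_recurrence n (n + 1)
    have hB := h.jointInt_boundary hs hp' n
    have e0 := ih.1 0
    have e1 := ih.2 0
    have e2 := ih.2 1
    simp only [zero_add, show 1 + (n + 1) = n + 2 by ring] at e0 e1 e2 ⊢
    rw [hp] at hB hJ
    rw [hs] at hJ
    rw [show (r : ℂ) - r₁ = r₂ by rw [hr']; ring] at hB
    rw [e0, e1, e2] at hb
    linear_combination -hb - (1 - r) / r * (-r₂) ^ (n + 1) * (hJ - hB
      + jointInt γ z₀ z₁ z₂ (n + 1) (n + 2) * hr')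

end WaitBalance

/-! ### Return to the queue and conclusion. -/

section Steady

open NPState

variable {N : ℕ} [NeZero N] {lamHi lamLo mu : ℝ} {P : NPState N → ℝ}

theorem waitBalance_waitJoint (hHi : 0 < lamHi) (hLo : 0 ≤ lamLo) (hmu : 0 < mu)
    (hP : IsSteadyState (npRate lamHi lamLo mu) P) :
    WaitBalance (lamHi / (N * mu)) (lamLo / (N * mu)) (waitJoint P) := by
  have hinj : Function.Injective fun x : ℕ × ℕ => (busy x.1 x.2 : NPState N) := by
    rintro ⟨a, b⟩ ⟨c, d⟩ h
    simpa using h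
  have hsum : Summable fun x : ℕ × ℕ => P (busy x.1 x.2) :=
    hP.total.summable.comp_injective hinj
  have hN : (0 : ℝ) < N := by exact_mod_cast NeZero.pos N
  have hNmu : (N * mu : ℝ) ≠ 0 := (mul_pos hN hmu).ne'
  have hT : 0 < ∑' x : ℕ × ℕ, P (busy x.1 x.2) := by
    obtain ⟨n, m, hne⟩ := exists_busy_ne_zero hP (by linarith)
    exact hsum.tsum_pos (fun x => hP.nonneg _) (n, m) (lt_of_le_of_ne (hP.nonneg _) hne.symm)
  refine ⟨fun n m => div_nonneg (hP.nonneg _) hT.le, ?_, ?_, fun m => ?_, fun n => ?_,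
    fun n m => ?_⟩
  · have := hsum.hasSum.div_const (∑' x : ℕ × ℕ, P (busy x.1 x.2))
    rwa [div_self hT.ne'] at this
  all_goals
    unfold waitJoint
    generalize (∑' x : ℕ × ℕ, P (busy x.1 x.2)) = T at hT
    have hT' := hT.ne'
    field_simp
  · linear_combination cut_busy_zero_zero hP
  · linear_combination balance_busy_zero_succ hP m
  · linear_combination balance_busy_succ_zero hP n
  · linear_combination balance_busy_succ_succ hP n m

end Steady

theorem exists_isRContour {z₀ z₁ z₂ : ℂ} (h₀ : z₁ ≠ z₀) (h₂ : z₁ ≠ z₂) :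
    ∃ γ : ℝ → ℂ, IsRContour z₀ z₁ z₂ γ := by
  have p0 : 0 < ‖z₀ - z₁‖ := norm_pos_iff.2 (sub_ne_zero.2 h₀.symm)
  have p2 : 0 < ‖z₂ - z₁‖ := norm_pos_iff.2 (sub_ne_zero.2 h₂.symm)
  obtain ⟨ρ, hρ, hlt⟩ := exists_between (lt_min p0 p2)
  exact ⟨_, isRContour_circle hρ (hlt.trans_le (min_le_left _ _))
    (hlt.trans_le (min_le_right _ _))⟩

theorem mainTheorem1 (N : ℕ) [NeZero N] (lamHi lamLo mu : ℝ)
    (hHi : 0 < lamHi) (hLo : 0 ≤ lamLo) (hmu : 0 < mu)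
    (r r₁ r₂ ν : ℝ)
    (hr₁ : r₁ = lamHi / (N * mu)) (hr₂ : r₂ = lamLo / (N * mu))
    (hr : r = r₁ + r₂) (hr_lt : r < 1) (hν : ν = r₁ / r)
    (z₀ z₁ z₂ : ℂ)
    (hz₀ : z₀ = (ν : ℂ)) (hz₁ : z₁ = (poleOne r ν : ℂ)) (hz₂ : z₂ = (poleTwo r ν : ℂ))
    (P : NPState N → ℝ) (hP : IsSteadyState (npRate lamHi lamLo mu) P) :
    (∀ m : ℕ, ∀ p : ℝ, 0 ≤ p → p < 1 →
      HasSum (fun n : ℕ => p ^ n * waitJoint P n m)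
        ((1 - r) * (1 - p) / (1 - p * cohenLam2 r r₁ r₂ p) * cohenLam1 r r₁ r₂ p ^ m)) ∧
    (∃ γ : ℝ → ℂ, IsRContour z₀ z₁ z₂ γ) ∧
    (∀ γ : ℝ → ℂ, IsRContour z₀ z₁ z₂ γ →
      (∀ n m : ℕ,
        (waitJoint P n m : ℂ) =
          (1 - (r : ℂ)) * (-(r₂ : ℂ)) ^ n / (r : ℂ) *
            (deltaRInt γ z₀ z₁ z₂ (m + n + 2) (n + 1)
              - z₁ * z₂ * deltaRInt γ z₀ z₁ z₂ (m + n) (n + 1))) ∧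
      (∀ n : ℕ,
        Summable (fun m : ℕ => waitJoint P n m) ∧
        (waitLow P n : ℂ) =
          -((1 - (r : ℂ)) * (-(r₂ : ℂ)) ^ n / (r : ℂ)) *
            (rInt γ z₀ z₁ z₂ (n + 2) (n + 1)
              - z₁ * z₂ * rInt γ z₀ z₁ z₂ n (n + 1)))) := by
  have hN : (0 : ℝ) < N := by exact_mod_cast NeZero.pos N
  have h1 : 0 < r₁ := hr₁ ▸ div_pos hHi (mul_pos hN hmu)
  have h2 : 0 ≤ r₂ := hr₂ ▸ div_nonneg hLo (mul_pos hN hmu).le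
  have hf : WaitBalance r₁ r₂ (waitJoint P) := by
    rw [hr₁, hr₂]
    exact waitBalance_waitJoint hHi hLo hmu hP
  have hr0 : 0 < r := by linarith
  have hνr : 4 * ν * r = 4 * r₁ := by rw [hν]; field_simp
  have hpole1 : poleOne r ν = cohenLam1 r r₁ r₂ 0 := by
    rw [poleOne, cohenLam1, hνr, mul_zero, sub_zero]
  have hpole2 : poleTwo r ν = cohenLam2 r r₁ r₂ 0 := by
    rw [poleTwo, cohenLam2, hνr, mul_zero, sub_zero]
  rw [hpole1] at hz₁
  rw [hpole2] at hz₂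
  have hlt := cohenLam1_lt_one h1 hr hr_lt h2 zero_le_one
  have hpos := cohenLam1_pos h1 hr hr_lt h2 zero_le_one
  have hle2 := one_le_cohenLam2 hr hr_lt h2 zero_le_one
  have hadd := cohenLam_add (r := r) (r₁ := r₁) (r₂ := r₂) (p := 0)
  have hmul := cohenLam_mul (cohen_disc_nonneg hr hr_lt h2 zero_le_one)
  refine ⟨fun m p hp0 hp => ?_, exists_isRContour ?_ ?_, fun γ hγ => ⟨fun n m => ?_,
    fun n => ⟨hf.summable_high n, ?_⟩⟩⟩
  · rw [← hf.lowGen_eq h1 hr hr_lt h2 hp0 hp]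
    exact hf.hasSum_lowGen hp0 hp.le m
  · rw [hz₁, hz₀]
    intro h
    have h' : cohenLam1 r r₁ r₂ 0 = ν := by exact_mod_cast h
    have hνr' : ν * r = r₁ := by linarith
    rw [h'] at hadd hmul hlt hpos
    -- Substituting `ν` into the quadratic at `p = 0` and using `ν * r = r₁` leaves this equation,
    -- impossible for a root in `(0, 1)`.
    have : ν * (1 - ν) = 0 := by linear_combination (-ν) * hadd + hmul - hνr'
    rcases mul_eq_zero.1 this with h | h <;> linarith
  · rw [hz₁, hz₂]
    intro h
    have h' : cohenLam1 r r₁ r₂ 0 = cohenLam2 r r₁ r₂ 0 := by exact_mod_cast h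
    linarith
  · exact hf.eq_jointInt h1 hr hr_lt h2 hγ hz₁ hz₂ (hz₀.trans (by rw [hν])) n m
  · have hn1 : ‖z₁‖ < 1 := by
      rwa [hz₁, Complex.norm_real, Real.norm_of_nonneg hpos.le]
    have t1 := (hγ.tendsto_sum_jointInt hn1 n (n + 1)).const_mul
      ((1 - (r : ℂ)) * (-(r₂ : ℂ)) ^ n / (r : ℂ))
    have t2 : Tendsto (fun M => ((∑ m ∈ Finset.range M, waitJoint P n m : ℝ) : ℂ)) atTop
        (𝓝 (waitLow P n : ℂ)) :=
      (Complex.continuous_ofReal.tendsto _).comp (hf.summable_high n).hasSum.tendsto_sum_nat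
    refine (tendsto_nhds_unique t2 (t1.congr fun M => ?_)).trans (by ring)
    rw [Complex.ofReal_sum, Finset.mul_sum]
    exact Finset.sum_congr rfl fun m _ =>
      (hf.eq_jointInt h1 hr hr_lt h2 hγ hz₁ hz₂ (hz₀.trans (by rw [hν])) n m).symm
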